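/- Let $0<\alpha\le 1$. For a square real matrix $M$ put $E_{\alpha,\alpha}(M)=\sum_{k\ge 0} M^k/\Gamma(\alpha k+\alpha)$, let $\boldsymbol e$ denote a column vector of ones, and let $$T=\begin{pmatrix}T_{11}&T_{12}&T_{13}\\0&T_{22}&0\\0&0&T_{33}\end{pmatrix},\qquad R=\begin{pmatrix}\boldsymbol e&\boldsymbol e\\ \boldsymbol e&\boldsymbol 0\\ \boldsymbol 0&\boldsymbol e\end{pmatrix},\qquad \pi=(\pi_1,\pi_2,\pi_3),$$ where $\pi_i$ is a row vector of length $p_i$ and $T_{ij}$ is a $p_i\times p_j$ matrix. Assume that $\pi\ge 0$ with $\pi\boldsymbol e\le 1$, and that $T$ is a nonsingular sub-intensity matrix (nonnegative off-diagonal entries and $t:=-T\boldsymbol e\ge 0$); write $t=(t_1,t_2,t_3)$ for the blocks of $t$. Let $Y=(Y_1,Y_2)$ have the distribution $\mathrm{MPH}^*_\alpha(\pi,T,R)$. This is the joint law of the total rewards $Y_k=\int_0^\tau\sum_i r_{ik}1\{X_s=i\}\,ds$, where $X$ is the semi-Markov process with initial distribution $\pi$ on the transient states (the mass $1-\pi\boldsymbol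 e$ being put on the absorbing state), jump probabilities $t_{ij}/(-t_{ii})$ to the states $j\ne i$ and $t_i/(-t_{ii})$ to the absorbing state, and sojourn times in the transient states $i$ that are independent of each other and of the embedded chain and have the density $\lambda_i x^{\alpha-1}E_{\alpha,\alpha}(-\lambda_i x^\alpha)$, $x>0$, with $\lambda_i=-t_{ii}$, and where $\tau$ is its absorption time. It is characterized as the probability law on $[0,\infty)^2$ with Laplace transform $$\mathbb E\,e^{-\langle Y,\theta\rangle}=1-\pi\boldsymbol e+\pi\bigl(\Delta(R\theta)^\alpha-T\bigr)^{-1}t,\qquad \theta\ge 0,$$ where $\Delta(R\theta)^\alpha$ is the diagonal matrix with the entries $(R\theta)_i^\alpha$. Then, under either description of this law, the law of $Y$ is the sum of the following parts, all of whose densities are nonnegative: 1. on $\{0<y<x\}$, the density with respect to Lebesgue measure $dx\,dy$ $$\pi_1\,y^{\alpha-1}E_{\alpha,\alpha}(T_{11}y^\alpha)\,T_{12}\,(x-y)^{\alpha-1}E_{\alpha,\alpha}(T_{22}(x-y)^\alpha)\,t_2;$$ 2. on $\{0<x<y\}$, the density with respect to Lebesgue measure $dx\,dy$ $$\pi_1\,x^{\alpha-1}E_{\alpha,\alpha}(T_{11}x^\alpha)\,T_{13}\,(y-x)^{\alpha-1}E_{\alpha,\alpha}(T_{33}(y-x)^\alpha)\,t_3;$$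 3. on the diagonal $\{(x,x):x>0\}$, the density $x^{\alpha-1}\pi_1E_{\alpha,\alpha}(T_{11}x^\alpha)t_1$ with respect to $dx$; 4. on the axis $\{(x,0):x>0\}$, the density $x^{\alpha-1}\pi_2E_{\alpha,\alpha}(T_{22}x^\alpha)t_2$ with respect to $dx$; 5. on the axis $\{(0,y):y>0\}$, the density $y^{\alpha-1}\pi_3E_{\alpha,\alpha}(T_{33}y^\alpha)t_3$ with respect to $dy$; 6. an atom of mass $1-\pi\boldsymbol e$ at the origin, which is absent when $\pi\boldsymbol e=1$. -/

import Mathlib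

open MeasureTheory ProbabilityTheory Matrix

namespace MPHalpha

noncomputable section

/-- The two-parameter Mittag-Leffler function `E_{α,β}(a) = ∑ₖ aᵏ / Γ(α k + β)`, for `a` in a
topological real algebra; it is used for real numbers and for square real matrices. -/
def mittagLeffler {A : Type*} [Ring A] [Algebra ℝ A] [TopologicalSpace A] (α β : ℝ) (a : A) : A :=
  ∑' k : ℕ, (Real.Gamma (α * k + β))⁻¹ • a ^ k

/-- The Mittag-Leffler distribution `ML(α, l)`, with density `l x^{α-1} E_{α,α}(-l x^α)`, `x > 0`. -/
def mlDistribution (α l : ℝ) : Measure ℝ :=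
  (volume.restrict (Set.Ioi 0)).withDensity fun x =>
    ENNReal.ofReal (l * x ^ (α - 1) * mittagLeffler α α (-l * x ^ α))

/-- The matrix Mittag-Leffler kernel `x^{α-1} E_{α,α}(T x^α)`. -/
def mlKernel {S : Type*} [Fintype S] [DecidableEq S] (α : ℝ) (T : Matrix S S ℝ) (x : ℝ) :
    Matrix S S ℝ :=
  x ^ (α - 1) • mittagLeffler α α (x ^ α • T)

/-- The vector `t = -T e` of exit rates. -/
def exitVector {S : Type*} [Fintype S] (T : Matrix S S ℝ) : S → ℝ :=
  -(T *ᵥ 1)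

/-- `(π, T)` are parameters of a (fractional) phase-type distribution: `π ≥ 0` with total mass at
most one (the missing mass is the probability of starting in the absorbing state), and `T` is a
sub-intensity matrix. All states being transient is expressed by `T` being nonsingular. -/
structure IsPHParam {S : Type*} [Fintype S] [DecidableEq S] (π : S → ℝ) (T : Matrix S S ℝ) :
    Prop where
  init_nonneg : ∀ i, 0 ≤ π i
  init_sum_le : ∑ i, π i ≤ 1
  offDiag_nonneg : ∀ i j, i ≠ j → 0 ≤ T i j
  exit_nonneg : ∀ i, 0 ≤ exitVector T i
  det_ne_zero : T.det ≠ 0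

/-! ### The semi-Markov reward construction

The state space is `Option S`, where `none` is the absorbing state. -/

/-- The initial distribution on `Option S`. -/
def initial {S : Type*} [Fintype S] (π : S → ℝ) : Option S → ℝ
  | some i => π i
  | none => 1 - ∑ i, π i

/-- The transition probabilities of the embedded chain: `q_{ij} = t_{ij} / λ_i` for `j ≠ i`, and
`t_i / λ_i` for absorption, with `λ_i = -t_{ii}`. -/
def embedded {S : Type*} [Fintype S] [DecidableEq S] (T : Matrix S S ℝ) :
    Option S → Option S → ℝ
  | some i, some j => if i = j then 0 else T i j / (-T i i)
  | some i, none => exitVector T i / (-T i i)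
  | none, some _ => 0
  | none, none => 1

/-- `Z` is the embedded Markov chain, started from `π`, and `H n i` is the length of the `n`-th
sojourn if it is spent in the state `i`; these are `ML(α, λ_i)`-distributed, mutually independent,
and independent of the chain. -/
structure IsSemiMarkovModel {S : Type*} [Fintype S] [DecidableEq S] (α : ℝ) (π : S → ℝ)
    (T : Matrix S S ℝ) {Ω : Type*} [MeasurableSpace Ω] (P : Measure Ω)
    (Z : ℕ → Ω → Option S) (H : ℕ → S → Ω → ℝ) : Prop where
  isProbabilityMeasure : IsProbabilityMeasure P
  measurable_chain : ∀ n, Measurable[_, ⊤] (Z n)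
  measurable_sojourn : ∀ n i, Measurable (H n i)
  markov : ∀ (n : ℕ) (z : ℕ → Option S), P.real {ω | ∀ m ≤ n, Z m ω = z m} =
    initial π (z 0) * ∏ m ∈ Finset.range n, embedded T (z m) (z (m + 1))
  sojourn_law : ∀ n i, HasLaw (H n i) (mlDistribution α (-T i i)) P
  sojourn_indep : iIndepFun (fun q : ℕ × S => H q.1 q.2) P
  chain_indep : Indep (⨆ n, MeasurableSpace.comap (Z n) ⊤)
    (⨆ q : ℕ × S, MeasurableSpace.comap (H q.1 q.2) inferInstance) P

/-- The time `S_n` of the `n`-th jump. From absorption on, `S_n` stays equal to the absorption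
time. -/
def jumpTime {S Ω : Type*} (Z : ℕ → Ω → Option S) (H : ℕ → S → Ω → ℝ) (n : ℕ) (ω : Ω) : ℝ :=
  ∑ m ∈ Finset.range n, (Z m ω).elim 0 fun i => H m i ω

open Classical in
/-- The semi-Markov process `X_t`: it equals `Z n` for `S_n ≤ t < S_{n+1}`, and is in the absorbing
state `none` once no sojourn in a transient state covers `t`. -/
def semiMarkov {S Ω : Type*} (Z : ℕ → Ω → Option S) (H : ℕ → S → Ω → ℝ) (t : ℝ) (ω : Ω) :
    Option S :=
  if h : ∃ n, jumpTime Z H n ω ≤ t ∧ t < jumpTime Z H (n + 1) ω then Z (Nat.find h) ω else none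

/-- The absorption time `τ = inf {t ≥ 0 | X_t is absorbed}`. -/
def absorptionTime {S Ω : Type*} (Z : ℕ → Ω → Option S) (H : ℕ → S → Ω → ℝ) (ω : Ω) : ℝ :=
  sInf {t : ℝ | 0 ≤ t ∧ semiMarkov Z H t ω = none}

open Classical in
/-- The vector of total rewards `Y_k = ∫_0^τ ∑_i r_{ik} 1{X_t = i} dt`. -/
def totalReward {S Ω : Type*} [Fintype S] {n : ℕ} (R : Matrix S (Fin n) ℝ)
    (Z : ℕ → Ω → Option S) (H : ℕ → S → Ω → ℝ) (ω : Ω) : Fin n → ℝ := fun k =>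
  ∫ t in (0 : ℝ)..absorptionTime Z H ω,
    ∑ i, R i k * (if semiMarkov Z H t ω = some i then 1 else 0)

/-! ### The Laplace transform of the class `MPH*_α` -/

/-- `μ` is the distribution `MPH*_α(π, T, R)`: the probability measure on the orthant `[0,∞)ⁿ` with
Laplace transform `π (Δ(Rθ)^α - T)⁻¹ t`, `θ ≥ 0`, where the missing initial mass `1 - π e` (which is
zero if `π` is a probability vector) gives an atom at the origin. -/
structure IsMPH {S : Type*} [Fintype S] [DecidableEq S] {n : ℕ} (α : ℝ) (π : S → ℝ)
    (T : Matrix S S ℝ) (R : Matrix S (Fin n) ℝ) (μ : Measure (Fin n → ℝ)) : Prop where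
  isProbabilityMeasure : IsProbabilityMeasure μ
  nonneg : ∀ᵐ y ∂μ, ∀ k, 0 ≤ y k
  laplace : ∀ θ : Fin n → ℝ, (∀ k, 0 ≤ θ k) →
    ∫ y, Real.exp (-(y ⬝ᵥ θ)) ∂μ =
      (1 - ∑ i, π i) +
        π ⬝ᵥ ((diagonal (fun i => (R *ᵥ θ) i ^ α) - T)⁻¹ *ᵥ exitVector T)

/-! ### The two-dimensional example -/

section Example

variable {p₁ p₂ p₃ : ℕ}

/-- The initial vector `(π₁, π₂, π₃)`. -/
def blockInit (π₁ : Fin p₁ → ℝ) (π₂ : Fin p₂ → ℝ) (π₃ : Fin p₃ → ℝ) :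
    Fin p₁ ⊕ (Fin p₂ ⊕ Fin p₃) → ℝ :=
  Sum.elim π₁ (Sum.elim π₂ π₃)

/-- The matrix with block rows `(T₁₁, T₁₂, T₁₃)`, `(0, T₂₂, 0)`, `(0, 0, T₃₃)`. -/
def blockT (T₁₁ : Matrix (Fin p₁) (Fin p₁) ℝ) (T₁₂ : Matrix (Fin p₁) (Fin p₂) ℝ)
    (T₁₃ : Matrix (Fin p₁) (Fin p₃) ℝ) (T₂₂ : Matrix (Fin p₂) (Fin p₂) ℝ)
    (T₃₃ : Matrix (Fin p₃) (Fin p₃) ℝ) :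
    Matrix (Fin p₁ ⊕ (Fin p₂ ⊕ Fin p₃)) (Fin p₁ ⊕ (Fin p₂ ⊕ Fin p₃)) ℝ :=
  fromBlocks T₁₁ (fromCols T₁₂ T₁₃) 0 (fromBlocks T₂₂ 0 0 T₃₃)

/-- The reward matrix with block rows `(e, e)`, `(e, 0)`, `(0, e)`. -/
def blockR (p₁ p₂ p₃ : ℕ) : Matrix (Fin p₁ ⊕ (Fin p₂ ⊕ Fin p₃)) (Fin 2) ℝ :=
  of (Sum.elim (fun _ => ![1, 1]) (Sum.elim (fun _ => ![1, 0]) (fun _ => ![0, 1])))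

/-- The Mittag-Leffler density `π x^{α-1} E_{α,α}(T x^α) t` on `(0, ∞)`. -/
def lineDensity {p : ℕ} (α : ℝ) (π : Fin p → ℝ) (T : Matrix (Fin p) (Fin p) ℝ)
    (t : Fin p → ℝ) (x : ℝ) : ℝ :=
  π ⬝ᵥ (mlKernel α T x *ᵥ t)

/-- The function `π u^{α-1} E_{α,α}(T u^α) D v^{α-1} E_{α,α}(T' v^α) t` of `u, v > 0`. -/
def planeDensity {p q : ℕ} (α : ℝ) (π : Fin p → ℝ) (T : Matrix (Fin p) (Fin p) ℝ)
    (D : Matrix (Fin p) (Fin q) ℝ) (T' : Matrix (Fin q) (Fin q) ℝ) (t : Fin q → ℝ)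
    (u v : ℝ) : ℝ :=
  π ⬝ᵥ ((mlKernel α T u * D * mlKernel α T' v) *ᵥ t)

/-- The measure on the plane composed of a density `f₁` (in `(x, y)`) with respect to Lebesgue
measure on `{0 < y < x}`, a density `f₂` on `{0 < x < y}`, a density `g` on the diagonal
`{(x, x) | x > 0}`, a density `h₁` on the axis `{(x, 0) | x > 0}`, a density `h₂` on the axis
`{(0, y) | y > 0}` (the last three with respect to the Lebesgue measure `dx` or `dy` of the
coordinate), and an atom of mass `c` at the origin. -/
def piecewiseMeasure (f₁ f₂ : ℝ → ℝ → ℝ) (g h₁ h₂ : ℝ → ℝ) (c : ℝ) : Measure (Fin 2 → ℝ) :=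
  (volume.restrict {z : Fin 2 → ℝ | 0 < z 1 ∧ z 1 < z 0}).withDensity
      (fun z => ENNReal.ofReal (f₁ (z 0) (z 1))) +
  (volume.restrict {z : Fin 2 → ℝ | 0 < z 0 ∧ z 0 < z 1}).withDensity
      (fun z => ENNReal.ofReal (f₂ (z 0) (z 1))) +
  ((volume.restrict (Set.Ioi 0)).withDensity (fun x => ENNReal.ofReal (g x))).map
      (fun x : ℝ => (![x, x] : Fin 2 → ℝ)) +
  ((volume.restrict (Set.Ioi 0)).withDensity (fun x => ENNReal.ofReal (h₁ x))).map
      (fun x : ℝ => (![x, 0] : Fin 2 → ℝ)) +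
  ((volume.restrict (Set.Ioi 0)).withDensity (fun y => ENNReal.ofReal (h₂ y))).map
      (fun y : ℝ => (![0, y] : Fin 2 → ℝ)) +
  ENNReal.ofReal c • Measure.dirac 0

/-- `μ` is the measure composed of the given piecewise density and atom, all of which are
nonnegative where they are used (so that no value is truncated in `piecewiseMeasure`). -/
structure HasPiecewiseDensity (μ : Measure (Fin 2 → ℝ)) (f₁ f₂ : ℝ → ℝ → ℝ) (g h₁ h₂ : ℝ → ℝ)
    (c : ℝ) : Prop where
  nonneg_lower : ∀ x y, 0 < y → y < x → 0 ≤ f₁ x y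
  nonneg_upper : ∀ x y, 0 < x → x < y → 0 ≤ f₂ x y
  nonneg_diag : ∀ x, 0 < x → 0 ≤ g x
  nonneg_axis₁ : ∀ x, 0 < x → 0 ≤ h₁ x
  nonneg_axis₂ : ∀ y, 0 < y → 0 ≤ h₂ y
  nonneg_atom : 0 ≤ c
  eq_measure : μ = piecewiseMeasure f₁ f₂ g h₁ h₂ c

/-- The explicit form of the distribution, for `α`, `(π₁, π₂, π₃)` and the block matrix `T`. -/
def HasExplicitForm (α : ℝ) (π₁ : Fin p₁ → ℝ) (π₂ : Fin p₂ → ℝ) (π₃ : Fin p₃ → ℝ)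
    (T₁₁ : Matrix (Fin p₁) (Fin p₁) ℝ) (T₁₂ : Matrix (Fin p₁) (Fin p₂) ℝ)
    (T₁₃ : Matrix (Fin p₁) (Fin p₃) ℝ) (T₂₂ : Matrix (Fin p₂) (Fin p₂) ℝ)
    (T₃₃ : Matrix (Fin p₃) (Fin p₃) ℝ) (μ : Measure (Fin 2 → ℝ)) : Prop :=
  let t := exitVector (blockT T₁₁ T₁₂ T₁₃ T₂₂ T₃₃)
  let t₁ : Fin p₁ → ℝ := fun i => t (Sum.inl i)
  let t₂ : Fin p₂ → ℝ := fun i => t (Sum.inr (Sum.inl i))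
  let t₃ : Fin p₃ → ℝ := fun i => t (Sum.inr (Sum.inr i))
  HasPiecewiseDensity μ
    (fun x y => planeDensity α π₁ T₁₁ T₁₂ T₂₂ t₂ y (x - y))
    (fun x y => planeDensity α π₁ T₁₁ T₁₃ T₃₃ t₃ x (y - x))
    (lineDensity α π₁ T₁₁ t₁)
    (lineDensity α π₂ T₂₂ t₂)
    (lineDensity α π₃ T₃₃ t₃)
    (1 - ∑ i, blockInit π₁ π₂ π₃ i)

end Example

end

end MPHalpha

/-!
The entrywise Laplace transform of the kernel `x^{α-1} E_{α,α}(T x^α)` is the resolvent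
`(s^α - T)⁻¹`. For small matrices or large `s` this is the termwise computation of a geometric
series. For a sub-intensity matrix `T` the kernel is moreover nonnegative: its transform is
completely monotone, and the Post-Widder inversion formula recovers the kernel as a limit of
derivatives with the right signs. Nonnegativity makes the transform converge for all `s > 0`.

The matrix `Δ(Rθ)^α - T` is block triangular with diagonal blocks `(θ₁ + θ₂)^α - T₁₁`,
`θ₁^α - T₂₂` and `θ₂^α - T₃₃`, so `π (Δ(Rθ)^α - T)⁻¹ t` is a sum of products of resolvents, and each
product is the transform of one of the stated parts. A measure on the orthant is determined by its
Laplace transform, by Stone-Weierstrass.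

For the semi-Markov process, the solution of `(Δ(Rθ)^α - T) x = t`, extended by `1` to the absorbing
state, is harmonic for the embedded chain with each sojourn weighted by the exponential of its
reward. Its expected value is therefore constant along the chain, and in the limit it becomes
`E exp (-⟨Y, θ⟩)`, because the chain is almost surely absorbed.
-/

namespace MPHalpha

section MittagLeffler

lemma inv_Gamma_le {M a : ℝ} (hM : 0 < M) (ha : 0 < a) :
    (Real.Gamma a)⁻¹ ≤ (M + 1) * Real.exp (M + 1) * (M ^ a)⁻¹ := by
  have hconv := Real.GammaIntegral_convergent ha
  have key : M ^ a * Real.exp (-(M + 1)) * (M + 1)⁻¹ ≤ Real.Gamma a := by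
    calc M ^ a * Real.exp (-(M + 1)) * (M + 1)⁻¹
        = ∫ _ in Set.Ioc M (M + 1), M ^ a * Real.exp (-(M + 1)) * (M + 1)⁻¹ := by simp
      _ ≤ ∫ x in Set.Ioc M (M + 1), Real.exp (-x) * x ^ (a - 1) := by
          refine setIntegral_mono_on (integrableOn_const (by simp))
            (hconv.mono_set fun x hx => hM.trans hx.1) measurableSet_Ioc fun x ⟨hMx, hxM⟩ => ?_
          have hx0 : 0 < x := hM.trans hMx
          rw [Real.rpow_sub_one hx0.ne', mul_comm (M ^ a), mul_assoc, ← div_eq_mul_inv]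
          gcongr
      _ ≤ ∫ x in Set.Ioi 0, Real.exp (-x) * x ^ (a - 1) := by
          refine setIntegral_mono_set hconv ?_
            (Filter.Eventually.of_forall fun x hx => hM.trans hx.1)
          filter_upwards [ae_restrict_mem measurableSet_Ioi] with x (hx : 0 < x)
          rw [Pi.zero_apply]
          positivity
      _ = Real.Gamma a := (Real.Gamma_eq_integral ha).symm
  rw [inv_le_comm₀ (Real.Gamma_pos_of_pos ha) (by positivity)]
  refine le_trans (le_of_eq ?_) key
  rw [Real.exp_neg]
  field_simp

lemma summable_inv_Gamma_mul_pow {α β : ℝ} (hα : 0 < α) (hβ : 0 < β) (c : ℝ) :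
    Summable fun k : ℕ => (Real.Gamma (α * k + β))⁻¹ * c ^ k := by
  set b : ℝ := 2 * |c| + 1
  have hb : 0 < b := by positivity
  set M : ℝ := b ^ α⁻¹
  have hM : 0 < M := Real.rpow_pos_of_pos hb _
  have hratio : |c| / b < 1 := by
    rw [div_lt_one hb]
    simp only [b]
    linarith [abs_nonneg c]
  refine Summable.of_norm_bounded (g := fun k : ℕ =>
    (M + 1) * Real.exp (M + 1) * (M ^ β)⁻¹ * (|c| / b) ^ k)
    ((summable_geometric_of_lt_one (by positivity) hratio).mul_left _) fun k => ?_
  have ha : 0 < α * k + β := by positivity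
  have hMpow : M ^ (α * k + β) = b ^ k * M ^ β := by
    rw [Real.rpow_add hM, Real.rpow_mul_natCast hM.le, Real.rpow_inv_rpow hb.le hα.ne']
  rw [norm_mul, norm_pow, Real.norm_eq_abs, Real.norm_eq_abs,
    abs_of_pos (inv_pos.2 (Real.Gamma_pos_of_pos ha))]
  calc (Real.Gamma (α * k + β))⁻¹ * |c| ^ k
      ≤ ((M + 1) * Real.exp (M + 1) * (M ^ (α * k + β))⁻¹) * |c| ^ k := by
        gcongr
        exact inv_Gamma_le hM ha
    _ = _ := by rw [hMpow, div_pow]; field_simp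

variable {A : Type*} [NormedRing A]

lemma norm_pow_le_norm_one_mul (a : A) (k : ℕ) : ‖a ^ k‖ ≤ ‖(1 : A)‖ * ‖a‖ ^ k := by
  induction k with
  | zero => simp
  | succ k ih =>
    rw [pow_succ, pow_succ, ← mul_assoc]
    exact (norm_mul_le _ _).trans (by gcongr)

variable [NormedAlgebra ℝ A] {α β : ℝ}

lemma norm_mittagLeffler_term_le (hα : 0 < α) (hβ : 0 < β) {a : A} {r : ℝ} (ha : ‖a‖ ≤ r)
    (k : ℕ) : ‖(Real.Gamma (α * k + β))⁻¹ • a ^ k‖ ≤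
      ‖(1 : A)‖ * ((Real.Gamma (α * k + β))⁻¹ * r ^ k) := by
  have hΓ := Real.Gamma_pos_of_pos (show 0 < α * k + β by positivity)
  rw [norm_smul, Real.norm_of_nonneg (inv_pos.2 hΓ).le, mul_left_comm]
  gcongr
  exact (norm_pow_le_norm_one_mul a k).trans (by gcongr)

variable [CompleteSpace A]

lemma summable_mittagLeffler (hα : 0 < α) (hβ : 0 < β) (a : A) :
    Summable fun k : ℕ => (Real.Gamma (α * k + β))⁻¹ • a ^ k :=
  .of_norm_bounded ((summable_inv_Gamma_mul_pow hα hβ ‖a‖).mul_left _)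
    (norm_mittagLeffler_term_le hα hβ le_rfl)

lemma continuous_mittagLeffler (hα : 0 < α) (hβ : 0 < β) :
    Continuous (mittagLeffler α β : A → A) := by
  rw [continuous_iff_continuousAt]
  intro a
  have hball : ContinuousOn (mittagLeffler α β : A → A) (Metric.closedBall 0 (‖a‖ + 1)) :=
    continuousOn_tsum (fun k => by fun_prop)
      ((summable_inv_Gamma_mul_pow hα hβ (‖a‖ + 1)).mul_left _) fun k b hb =>
        norm_mittagLeffler_term_le hα hβ (mem_closedBall_zero_iff.1 hb) k
  exact hball.continuousAt (Metric.closedBall_mem_nhds_of_mem (by simp))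

end MittagLeffler

section LaplaceTransform

lemma integrable_tsum_of_summable_integral_norm {X E ι : Type*} [MeasurableSpace X]
    {μ : Measure X} [NormedAddCommGroup E] [Countable ι] {F : ι → X → E}
    (hF : ∀ i, Integrable (F i) μ) (hsum : Summable fun i => ∫ x, ‖F i x‖ ∂μ)
    (hmeas : AEStronglyMeasurable (fun x => ∑' i, F i x) μ) :
    Integrable (fun x => ∑' i, F i x) μ := by
  refine ⟨hmeas, ?_⟩
  calc ∫⁻ x, ‖∑' i, F i x‖ₑ ∂μ ≤ ∫⁻ x, ∑' i, ‖F i x‖ₑ ∂μ :=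
        lintegral_mono fun _ => enorm_tsum_le_tsum_enorm
    _ = ∑' i, ENNReal.ofReal (∫ x, ‖F i x‖ ∂μ) := by
        rw [lintegral_tsum fun i => (hF i).1.enorm]
        simp_rw [ofReal_integral_norm_eq_lintegral_enorm (hF _)]
    _ < ⊤ := by
        rw [← ENNReal.ofReal_tsum_of_nonneg (fun i => integral_nonneg fun _ => norm_nonneg _) hsum]
        exact ENNReal.ofReal_lt_top

lemma integrableOn_rpow_mul_exp_neg_mul {a s : ℝ} (ha : 0 < a) (hs : 0 < s) :
    IntegrableOn (fun x : ℝ => x ^ (a - 1) * Real.exp (-(s * x))) (Set.Ioi 0) := by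
  simpa using integrableOn_rpow_mul_exp_neg_mul_rpow (s := a - 1) (p := 1) (b := s) (by linarith)
    one_pos hs

variable {A : Type*} [NormedRing A] [NormedAlgebra ℝ A] {α β s : ℝ}

lemma continuousOn_mittagLeffler_kernel [CompleteSpace A] (hα : 0 < α) (hβ : 0 < β) (a : A) :
    ContinuousOn (fun x : ℝ => x ^ (β - 1) • mittagLeffler α β (x ^ α • a)) (Set.Ioi 0) := by
  have hpow (γ : ℝ) : ContinuousOn (fun x : ℝ => x ^ γ) (Set.Ioi 0) :=
    continuousOn_id.rpow_const fun x hx => Or.inl (ne_of_gt hx)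
  exact (hpow _).smul <| (continuous_mittagLeffler hα hβ).comp_continuousOn <|
    (hpow α).smul continuousOn_const

lemma exp_smul_mittagLeffler_kernel_eq_tsum (s : ℝ) (a : A) {x : ℝ} (hx : 0 < x) :
    Real.exp (-(s * x)) • x ^ (β - 1) • mittagLeffler α β (x ^ α • a) =
      ∑' k : ℕ, (x ^ (α * k + β - 1) * Real.exp (-(s * x))) •
        (Real.Gamma (α * k + β))⁻¹ • a ^ k := by
  rw [smul_smul, mittagLeffler, ← tsum_const_smul'']
  refine tsum_congr fun k => ?_
  rw [smul_pow, ← Real.rpow_mul_natCast hx.le, smul_comm _ (x ^ (α * k)), smul_smul,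
    show α * k + β - 1 = (β - 1) + α * k by ring, Real.rpow_add hx]
  ring_nf

lemma integral_rpow_mul_exp_neg_mul_mul_inv_Gamma (hα : 0 < α) (hβ : 0 < β) (hs : 0 < s) (k : ℕ) :
    (∫ x in Set.Ioi (0 : ℝ), x ^ (α * k + β - 1) * Real.exp (-(s * x))) *
      (Real.Gamma (α * k + β))⁻¹ = s ^ (-β) * ((s ^ α)⁻¹) ^ k := by
  have ha : 0 < α * k + β := by positivity
  rw [Real.integral_rpow_mul_exp_neg_mul_Ioi ha hs,
    mul_inv_cancel_right₀ (Real.Gamma_pos_of_pos ha).ne', one_div, Real.inv_rpow hs.le,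
    Real.rpow_add hs, Real.rpow_mul_natCast hs.le, Real.rpow_neg hs.le, inv_pow]
  ring

variable (hα : 0 < α) (hβ : 0 < β) (hs : 0 < s)
include hα hβ hs

lemma integrableOn_mittagLeffler_kernel_term (a : A) (k : ℕ) :
    IntegrableOn (fun x : ℝ => (x ^ (α * k + β - 1) * Real.exp (-(s * x))) •
      (Real.Gamma (α * k + β))⁻¹ • a ^ k) (Set.Ioi 0) :=
  (integrableOn_rpow_mul_exp_neg_mul (by positivity) hs).smul_const _

variable {a : A} (ha : ‖a‖ < s ^ α)
include ha

lemma summable_integral_norm_mittagLeffler_kernel_term :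
    Summable fun k : ℕ => ∫ x in Set.Ioi (0 : ℝ),
      ‖(x ^ (α * k + β - 1) * Real.exp (-(s * x))) • (Real.Gamma (α * k + β))⁻¹ • a ^ k‖ := by
  have hsα := Real.rpow_pos_of_pos hs α
  have hterm (k : ℕ) : ∫ x in Set.Ioi (0 : ℝ),
      ‖(x ^ (α * k + β - 1) * Real.exp (-(s * x))) • (Real.Gamma (α * k + β))⁻¹ • a ^ k‖ =
      s ^ (-β) * ((s ^ α)⁻¹ ^ k * ‖a ^ k‖) := by
    have hΓ := Real.Gamma_pos_of_pos (show 0 < α * k + β by positivity)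
    rw [← mul_assoc, ← integral_rpow_mul_exp_neg_mul_mul_inv_Gamma hα hβ hs, mul_assoc,
      ← integral_mul_const]
    refine setIntegral_congr_fun measurableSet_Ioi fun x (hx : 0 < x) => ?_
    simp only [norm_smul]
    rw [Real.norm_of_nonneg (by positivity), Real.norm_of_nonneg (inv_pos.2 hΓ).le]
  simp_rw [hterm]
  refine Summable.mul_left _ (.of_nonneg_of_le (fun k => by positivity) (fun k => ?_)
    ((summable_geometric_of_lt_one (by positivity) ((div_lt_one hsα).2 ha)).mul_left ‖(1 : A)‖))
  calc (s ^ α)⁻¹ ^ k * ‖a ^ k‖ ≤ (s ^ α)⁻¹ ^ k * (‖(1 : A)‖ * ‖a‖ ^ k) := by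
        gcongr
        exact norm_pow_le_norm_one_mul a k
    _ = ‖(1 : A)‖ * (‖a‖ / s ^ α) ^ k := by
        rw [div_eq_mul_inv, mul_pow]
        ring

variable [CompleteSpace A]

lemma integrableOn_exp_smul_mittagLeffler_kernel :
    IntegrableOn (fun x : ℝ => Real.exp (-(s * x)) • x ^ (β - 1) • mittagLeffler α β (x ^ α • a))
      (Set.Ioi 0) := by
  have hseries := fun (x : ℝ) (hx : x ∈ Set.Ioi (0 : ℝ)) =>
    exp_smul_mittagLeffler_kernel_eq_tsum (α := α) (β := β) s a hx
  rw [integrableOn_congr_fun hseries measurableSet_Ioi]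
  refine integrable_tsum_of_summable_integral_norm
    (integrableOn_mittagLeffler_kernel_term hα hβ hs a)
    (summable_integral_norm_mittagLeffler_kernel_term hα hβ hs ha) ?_
  have hcont : ContinuousOn (fun x : ℝ => Real.exp (-(s * x))) (Set.Ioi 0) := by fun_prop
  exact ((hcont.smul (continuousOn_mittagLeffler_kernel hα hβ a)).congr fun x hx =>
    (hseries x hx).symm).aestronglyMeasurable measurableSet_Ioi

lemma integral_exp_smul_mittagLeffler_kernel :
    ∫ x in Set.Ioi (0 : ℝ), Real.exp (-(s * x)) • x ^ (β - 1) • mittagLeffler α β (x ^ α • a) =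
      s ^ (-β) • ∑' k : ℕ, ((s ^ α)⁻¹ • a) ^ k := by
  have hswap := integral_tsum_of_summable_integral_norm
    (integrableOn_mittagLeffler_kernel_term hα hβ hs a)
    (summable_integral_norm_mittagLeffler_kernel_term hα hβ hs ha)
  rw [setIntegral_congr_fun measurableSet_Ioi fun x hx =>
    exp_smul_mittagLeffler_kernel_eq_tsum s a hx, ← hswap, ← tsum_const_smul'']
  refine tsum_congr fun k => ?_
  rw [integral_smul_const, smul_smul, integral_rpow_mul_exp_neg_mul_mul_inv_Gamma hα hβ hs,
    smul_pow, smul_smul]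

lemma smul_one_sub_mul_integral_exp_smul_mittagLeffler_kernel :
    (s ^ α • (1 : A) - a) * (∫ x in Set.Ioi (0 : ℝ),
      Real.exp (-(s * x)) • x ^ (β - 1) • mittagLeffler α β (x ^ α • a)) = s ^ (α - β) • 1 := by
  have hsα := Real.rpow_pos_of_pos hs α
  have hnorm : ‖(s ^ α)⁻¹ • a‖ < 1 := by
    rw [norm_smul, norm_inv, Real.norm_of_nonneg hsα.le, inv_mul_lt_one₀ hsα]
    exact ha
  have hfactor : s ^ α • (1 : A) - a = s ^ α • (1 - (s ^ α)⁻¹ • a) := by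
    rw [smul_sub, smul_inv_smul₀ hsα.ne']
  rw [integral_exp_smul_mittagLeffler_kernel hα hβ hs ha, hfactor, smul_mul_smul_comm,
    mul_neg_geom_series _ hnorm, ← Real.rpow_add hs,
    sub_eq_add_neg]

end LaplaceTransform

section CompletelyMonotone

/-- Complete monotonicity up to order `n` on `(s₀, ∞)`: the derivatives of `f` of order at most `n`
exist there and, multiplied with alternating signs, are nonnegative. -/
def CompletelyMonotoneUpTo (s₀ : ℝ) : ℕ → (ℝ → ℝ) → Prop
  | 0, f => ∀ s > s₀, 0 ≤ f s
  | n + 1, f => (∀ s > s₀, 0 ≤ f s) ∧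
      ∃ g : ℝ → ℝ, (∀ s > s₀, HasDerivAt f (-g s) s) ∧ CompletelyMonotoneUpTo s₀ n g

namespace CompletelyMonotoneUpTo

variable {s₀ : ℝ} {n : ℕ} {f g : ℝ → ℝ}

lemma nonneg (hf : CompletelyMonotoneUpTo s₀ n f) : ∀ s > s₀, 0 ≤ f s := by
  cases n with
  | zero => exact hf
  | succ n => exact hf.1

lemma of_succ (hf : CompletelyMonotoneUpTo s₀ (n + 1) f) : CompletelyMonotoneUpTo s₀ n f := by
  induction n generalizing f with
  | zero => exact hf.1
  | succ n ih =>
    obtain ⟨h0, g, hg, hgn⟩ := hf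
    exact ⟨h0, g, hg, ih hgn⟩

lemma congr (hf : CompletelyMonotoneUpTo s₀ n f) (h : ∀ s > s₀, f s = g s) :
    CompletelyMonotoneUpTo s₀ n g := by
  cases n with
  | zero => exact fun s hs => h s hs ▸ hf s hs
  | succ n =>
    obtain ⟨h0, f', hf', hn⟩ := hf
    refine ⟨fun s hs => h s hs ▸ h0 s hs, f', fun s hs => (hf' s hs).congr_of_eventuallyEq ?_, hn⟩
    filter_upwards [Ioi_mem_nhds hs] with u hu using (h u hu).symm

lemma add (hf : CompletelyMonotoneUpTo s₀ n f) (hg : CompletelyMonotoneUpTo s₀ n g) :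
    CompletelyMonotoneUpTo s₀ n fun s => f s + g s := by
  induction n generalizing f g with
  | zero => exact fun s hs => add_nonneg (hf s hs) (hg s hs)
  | succ n ih =>
    obtain ⟨h0, f', hf', hn⟩ := hf
    obtain ⟨k0, g', hg', kn⟩ := hg
    refine ⟨fun s hs => add_nonneg (h0 s hs) (k0 s hs), _, fun s hs => ?_, ih hn kn⟩
    exact ((hf' s hs).add (hg' s hs)).congr_deriv (by ring)

lemma mul (hf : CompletelyMonotoneUpTo s₀ n f) (hg : CompletelyMonotoneUpTo s₀ n g) :
    CompletelyMonotoneUpTo s₀ n fun s => f s * g s := by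
  induction n generalizing f g with
  | zero => exact fun s hs => mul_nonneg (hf s hs) (hg s hs)
  | succ n ih =>
    have hf0 := hf.of_succ
    have hg0 := hg.of_succ
    obtain ⟨h0, f', hf', hn⟩ := hf
    obtain ⟨k0, g', hg', kn⟩ := hg
    refine ⟨fun s hs => mul_nonneg (h0 s hs) (k0 s hs), _, fun s hs => ?_,
      (ih hn hg0).add (ih hf0 kn)⟩
    exact ((hf' s hs).mul (hg' s hs)).congr_deriv (by ring)

lemma const {c : ℝ} (hc : 0 ≤ c) : CompletelyMonotoneUpTo s₀ n fun _ => c := by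
  induction n generalizing c with
  | zero => exact fun _ _ => hc
  | succ n ih =>
    exact ⟨fun _ _ => hc, fun _ => 0, fun s _ => by simpa using hasDerivAt_const s c, ih le_rfl⟩

lemma sum {ι : Type*} (A : Finset ι) {F : ι → ℝ → ℝ} (hF : ∀ i, CompletelyMonotoneUpTo s₀ n (F i)) :
    CompletelyMonotoneUpTo s₀ n fun s => ∑ i ∈ A, F i s := by
  classical
  induction A using Finset.induction_on with
  | empty => simpa using const le_rfl
  | insert i A hi ih =>
    simp_rw [Finset.sum_insert hi]
    exact (hF i).add ih

lemma rpow (hs₀ : 0 ≤ s₀) {b : ℝ} (hb : b ≤ 0) : CompletelyMonotoneUpTo s₀ n fun s => s ^ b := by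
  induction n generalizing b with
  | zero => exact fun s hs => Real.rpow_nonneg (hs₀.trans (le_of_lt hs)) _
  | succ n ih =>
    refine ⟨fun s hs => Real.rpow_nonneg (hs₀.trans (le_of_lt hs)) _, fun s => -b * s ^ (b - 1),
      fun s hs => ?_, (const (neg_nonneg.2 hb)).mul (ih (by linarith))⟩
    exact (Real.hasDerivAt_rpow_const (Or.inl (hs₀.trans_lt hs).ne')).congr_deriv (by ring)

end CompletelyMonotoneUpTo

end CompletelyMonotone

section PostWidder

/-- The Laplace transform of a real function on `(0, ∞)`. -/
noncomputable def laplaceTransform (f : ℝ → ℝ) (s : ℝ) : ℝ :=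
  ∫ u in Set.Ioi 0, Real.exp (-(s * u)) * f u

lemma integrableOn_exp_mul_id_mul {f : ℝ → ℝ} {r s : ℝ} (hrs : r < s)
    (hf : IntegrableOn (fun u => Real.exp (-(r * u)) * f u) (Set.Ioi 0)) :
    IntegrableOn (fun u => Real.exp (-(s * u)) * (u * f u)) (Set.Ioi 0) := by
  have hd : 0 < s - r := sub_pos.2 hrs
  have hfactor (u : ℝ) : Real.exp (-(s * u)) * (u * f u) =
      (u * Real.exp (-((s - r) * u))) * (Real.exp (-(r * u)) * f u) := by
    rw [show -(s * u) = -((s - r) * u) + -(r * u) by ring, Real.exp_add]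
    ring
  simp_rw [hfactor]
  refine Integrable.bdd_mul (c := (s - r)⁻¹) hf
    (by fun_prop : Measurable fun u : ℝ => u * Real.exp (-((s - r) * u))).aestronglyMeasurable ?_
  filter_upwards [ae_restrict_mem measurableSet_Ioi] with u (hu : 0 < u)
  have hexp := Real.add_one_le_exp ((s - r) * u)
  rw [Real.norm_of_nonneg (by positivity), Real.exp_neg, ← div_eq_mul_inv,
    div_le_iff₀ (Real.exp_pos _), le_inv_mul_iff₀ hd]
  linarith

lemma hasDerivAt_laplaceTransform {f : ℝ → ℝ} {s₀ : ℝ}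
    (hf : ∀ s > s₀, IntegrableOn (fun u => Real.exp (-(s * u)) * f u) (Set.Ioi 0))
    {s : ℝ} (hs : s₀ < s) :
    HasDerivAt (laplaceTransform f) (-laplaceTransform (fun u => u * f u) s) s := by
  obtain ⟨r, hr₀, hrs⟩ := exists_between hs
  obtain ⟨q, hq₀, hqr⟩ := exists_between hr₀
  have hderiv := (hasDerivAt_integral_of_dominated_loc_of_deriv_le
    (μ := volume.restrict (Set.Ioi 0)) (F := fun t u => Real.exp (-(t * u)) * f u)
    (F' := fun t u => -(Real.exp (-(t * u)) * (u * f u)))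
    (bound := fun u => ‖Real.exp (-(r * u)) * (u * f u)‖)
    (x₀ := s) (Ioi_mem_nhds hrs) ?_ (hf s hs)
    (integrableOn_exp_mul_id_mul (hqr.trans hrs) (hf q hq₀)).neg.1 ?_
    (integrableOn_exp_mul_id_mul hqr (hf q hq₀)).norm ?_).2
  · rw [integral_neg] at hderiv
    exact hderiv
  · filter_upwards [Ioi_mem_nhds hs] with t ht using (hf t ht).1
  · filter_upwards [ae_restrict_mem measurableSet_Ioi] with u (hu : 0 < u) t (ht : r < t)
    rw [norm_neg, norm_mul, norm_mul (Real.exp _), Real.norm_eq_abs (Real.exp _),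
      Real.norm_eq_abs (Real.exp _), Real.abs_exp, Real.abs_exp]
    gcongr
  · filter_upwards with u t _
    have hlin : HasDerivAt (fun t : ℝ => -(t * u)) (-u) t := by
      simpa using ((hasDerivAt_id' t).mul_const u).fun_neg
    exact (hlin.exp.mul_const (f u)).congr_deriv (by ring)

lemma CompletelyMonotoneUpTo.laplaceTransform_id_mul {f : ℝ → ℝ} {s₀ : ℝ} {n : ℕ}
    (hf : ∀ s > s₀, IntegrableOn (fun u => Real.exp (-(s * u)) * f u) (Set.Ioi 0))
    (h : CompletelyMonotoneUpTo s₀ (n + 1) (laplaceTransform f)) :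
    CompletelyMonotoneUpTo s₀ n (laplaceTransform fun u => u * f u) := by
  obtain ⟨-, g, hg, hn⟩ := h
  exact hn.congr fun s hs => neg_injective ((hg s hs).unique (hasDerivAt_laplaceTransform hf hs))

lemma laplaceTransform_pow_mul_nonneg {f : ℝ → ℝ} {s₀ : ℝ}
    (hf : ∀ s > s₀, IntegrableOn (fun u => Real.exp (-(s * u)) * f u) (Set.Ioi 0))
    (h : ∀ n, CompletelyMonotoneUpTo s₀ n (laplaceTransform f)) (k : ℕ) {s : ℝ} (hs : s₀ < s) :
    0 ≤ laplaceTransform (fun u => u ^ k * f u) s := by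
  induction k generalizing f with
  | zero => simpa using (h 0).nonneg s hs
  | succ k ih =>
    simp_rw [pow_succ, mul_assoc]
    refine ih (fun t ht => ?_) fun n => (h (n + 1)).laplaceTransform_id_mul hf
    obtain ⟨r, hr₀, hrt⟩ := exists_between ht
    exact integrableOn_exp_mul_id_mul hrt (hf r hr₀)

lemma mul_exp_one_sub_lt_one {z : ℝ} (hz : z ≠ 1) : z * Real.exp (1 - z) < 1 := by
  have hlt := Real.add_one_lt_exp (sub_ne_zero.2 hz)
  rw [sub_add_cancel] at hlt
  rwa [← neg_sub, Real.exp_neg, ← div_eq_mul_inv, div_lt_one (Real.exp_pos _)]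

lemma mul_exp_one_sub_le {c z : ℝ} (hc : 0 ≤ c) (h : 0 ≤ (c - 1) * (z - c)) :
    z * Real.exp (1 - z) ≤ c * Real.exp (1 - c) := by
  have hz : z ≤ c * Real.exp (z - c) :=
    calc z ≤ c * (z - c + 1) := by linarith
      _ ≤ c * Real.exp (z - c) := by gcongr; exact Real.add_one_le_exp _
  calc z * Real.exp (1 - z) ≤ c * Real.exp (z - c) * Real.exp (1 - z) := by gcongr
    _ = c * Real.exp (1 - c) := by rw [mul_assoc, ← Real.exp_add]; ring_nf

lemma exists_mul_exp_one_sub_le_of_notMem {v : Set ℝ} (hv : v ∈ nhds 1) :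
    ∃ q, 0 < q ∧ q < 1 ∧ ∀ z ∉ v, z * Real.exp (1 - z) ≤ q := by
  obtain ⟨e, he, hev⟩ := Metric.mem_nhds_iff.1 hv
  set d : ℝ := min e 1
  have hd : 0 < d := by positivity
  refine ⟨max ((1 + d) * Real.exp (1 - (1 + d))) ((1 - d) * Real.exp (1 - (1 - d))),
    lt_max_of_lt_left (by positivity),
    max_lt (mul_exp_one_sub_lt_one (by linarith)) (mul_exp_one_sub_lt_one (by linarith)),
    fun z hz => ?_⟩
  have hdz : d ≤ |z - 1| :=
    (min_le_left _ _).trans (not_lt.1 fun hlt => hz (hev (Metric.mem_ball.2 hlt)))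
  rcases le_abs.1 hdz with hzd | hzd
  · exact le_max_of_le_left (mul_exp_one_sub_le (by linarith)
      (mul_nonneg (by linarith) (by linarith)))
  · exact le_max_of_le_right (mul_exp_one_sub_le (sub_nonneg.2 (min_le_right _ _))
      (mul_nonneg_of_nonpos_of_nonpos (by linarith) (by linarith)))

/-- The kernel of the Post-Widder inversion formula, a density with respect to the weight
`exp (-(r * u))` on `(0, ∞)` which concentrates at `x` as `n → ∞`. -/
noncomputable def postWidderKernel (r x : ℝ) (n : ℕ) (u : ℝ) : ℝ :=
  (n / x + r) ^ (n + 1) / n.factorial * u ^ n * Real.exp (-(n / x * u))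

variable {r x : ℝ}

lemma exp_mul_postWidderKernel (r x : ℝ) (n : ℕ) (u : ℝ) :
    Real.exp (-(r * u)) * postWidderKernel r x n u =
      (n / x + r) ^ (n + 1) / n.factorial * (Real.exp (-((n / x + r) * u)) * u ^ n) := by
  rw [postWidderKernel, show -((n / x + r) * u) = -(r * u) + -(n / x * u) by ring, Real.exp_add]
  ring

lemma integral_exp_mul_postWidderKernel (hr : 0 < r) (hx : 0 < x) (n : ℕ) :
    ∫ u in Set.Ioi 0, Real.exp (-(r * u)) * postWidderKernel r x n u = 1 := by
  have hb : 0 < n / x + r := by positivity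
  have hΓ := Real.integral_rpow_mul_exp_neg_mul_Ioi (a := n + 1) (by positivity) hb
  simp only [add_sub_cancel_right, Real.rpow_natCast, Real.Gamma_nat_eq_factorial] at hΓ
  simp_rw [exp_mul_postWidderKernel, mul_comm (Real.exp _)]
  rw [integral_const_mul, hΓ, ← Nat.cast_add_one, Real.rpow_natCast, one_div, inv_pow]
  field_simp

lemma postWidderKernel_le (hr : 0 ≤ r) (hx : 0 < x) (n : ℕ) {u : ℝ} (hu : 0 ≤ u) :
    postWidderKernel r x n u ≤
      Real.exp (r * x) * (n / x + r) * (u / x * Real.exp (1 - u / x)) ^ n := by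
  have hn : (n / x + r) ^ n * x ^ n / n.factorial ≤ Real.exp (r * x) * Real.exp n := by
    rw [← mul_pow, ← Real.exp_add, add_mul, div_mul_cancel₀ _ hx.ne', add_comm]
    exact Real.pow_div_factorial_le_exp _ (by positivity) n
  calc postWidderKernel r x n u
      = (n / x + r) ^ n * x ^ n / n.factorial *
          ((n / x + r) * (u / x) ^ n * Real.exp (-(n / x * u))) := by
        rw [postWidderKernel, div_pow, pow_succ]
        field_simp
    _ ≤ Real.exp (r * x) * Real.exp n *
          ((n / x + r) * (u / x) ^ n * Real.exp (-(n / x * u))) := by gcongr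
    _ = _ := by
        rw [mul_pow, ← Real.exp_nat_mul, show n * (1 - u / x) = n + -(n / x * u) by ring,
          Real.exp_add]
        ring

lemma tendstoUniformlyOn_postWidderKernel (hr : 0 ≤ r) (hx : 0 < x) {v : Set ℝ} (hv : v ∈ nhds x) :
    TendstoUniformlyOn (postWidderKernel r x) 0 Filter.atTop (Set.Ioi 0 \ v) := by
  have hv' : (fun z : ℝ => z * x) ⁻¹' v ∈ nhds 1 :=
    (continuous_mul_const x).continuousAt.preimage_mem_nhds (by simpa using hv)
  obtain ⟨q, hq0, hq1, hq⟩ := exists_mul_exp_one_sub_le_of_notMem hv'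
  have hlim : Filter.Tendsto (fun n : ℕ => Real.exp (r * x) * (n / x + r) * q ^ n)
      Filter.atTop (nhds 0) := by
    have hn := (tendsto_self_mul_const_pow_of_lt_one hq0.le hq1).const_mul (Real.exp (r * x) / x)
    have hc := (tendsto_pow_atTop_nhds_zero_of_lt_one hq0.le hq1).const_mul (Real.exp (r * x) * r)
    simpa using (hn.add hc).congr fun n => by ring
  refine Metric.tendstoUniformlyOn_iff.2 fun ε hε => ?_
  filter_upwards [hlim.eventually_lt_const hε] with n hn u ⟨(hu : 0 < u), huv⟩
  have hle := (postWidderKernel_le hr hx n hu.le).trans (b := _)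
    (mul_le_mul_of_nonneg_left (pow_le_pow_left₀ (by positivity)
      (hq (u / x) (by simpa [hx.ne'] using huv)) n) (by positivity))
  rw [Pi.zero_apply, dist_comm, Real.dist_eq, sub_zero, abs_of_nonneg]
  · exact hle.trans_lt hn
  · rw [postWidderKernel]
    positivity

lemma tendsto_laplaceTransform_pow_mul (hr : 0 < r) (hx : 0 < x) {f : ℝ → ℝ}
    (hf : IntegrableOn (fun u => Real.exp (-(r * u)) * f u) (Set.Ioi 0))
    (hfx : ContinuousAt f x) :
    Filter.Tendsto (fun n : ℕ => (n / x + r) ^ (n + 1) / n.factorial *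
      laplaceTransform (fun u => u ^ n * f u) (n / x + r)) Filter.atTop (nhds (f x)) := by
  -- The weight `exp (-(r * u))` makes the measure of `(0, ∞)` finite.
  set ν : Measure ℝ := volume.withDensity fun u => ENNReal.ofReal (Real.exp (-(r * u)))
  have hmeas : Measurable fun u : ℝ => ENNReal.ofReal (Real.exp (-(r * u))) := by fun_prop
  have hν (g : ℝ → ℝ) : ∫ u in Set.Ioi 0, g u ∂ν =
      ∫ u in Set.Ioi 0, Real.exp (-(r * u)) * g u := by
    rw [setIntegral_withDensity_eq_setIntegral_toReal_smul hmeas (by simp) _ measurableSet_Ioi]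
    simp only [ENNReal.toReal_ofReal (Real.exp_nonneg _), smul_eq_mul]
  have hfν : IntegrableOn f (Set.Ioi 0) ν := by
    rw [IntegrableOn, restrict_withDensity measurableSet_Ioi,
      integrable_withDensity_iff_integrable_smul' hmeas (by simp)]
    simp only [ENNReal.toReal_ofReal (Real.exp_nonneg _), smul_eq_mul]
    exact hf
  have hfinite : ν (Set.Ioi 0) ≠ ⊤ := by
    have hexp := integrableOn_rpow_mul_exp_neg_mul one_pos hr
    simp only [sub_self, Real.rpow_zero, one_mul] at hexp
    rw [withDensity_apply _ measurableSet_Ioi]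
    exact hexp.lintegral_lt_top.ne
  have hpeak := tendsto_setIntegral_peak_smul_of_integrableOn_of_tendsto (μ := ν)
    (φ := postWidderKernel r x) (l := Filter.atTop) measurableSet_Ioi measurableSet_Ioi
    subset_rfl self_mem_nhdsWithin hfinite
    (.of_forall fun n u (hu : 0 < u) => by rw [postWidderKernel]; positivity)
    (fun v hv hxv => tendstoUniformlyOn_postWidderKernel hr.le hx (hv.mem_nhds hxv))
    (by simp [hν, integral_exp_mul_postWidderKernel hr hx])
    (.of_forall fun n => by unfold postWidderKernel; fun_prop)
    hfν hfx.continuousWithinAt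
  refine hpeak.congr fun n => ?_
  simp_rw [hν, smul_eq_mul, ← mul_assoc, exp_mul_postWidderKernel]
  rw [laplaceTransform, ← integral_const_mul]
  ring_nf

lemma nonneg_of_completelyMonotone_laplaceTransform {f : ℝ → ℝ} {s₀ : ℝ}
    (hfx : ContinuousAt f x)
    (hf : ∀ s > s₀, IntegrableOn (fun u => Real.exp (-(s * u)) * f u) (Set.Ioi 0))
    (h : ∀ n, CompletelyMonotoneUpTo s₀ n (laplaceTransform f)) (hx : 0 < x) : 0 ≤ f x := by
  set r : ℝ := max s₀ 0 + 1
  have hr : 0 < r := by positivity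
  have hrs : s₀ < r := by linarith [le_max_left s₀ 0]
  refine ge_of_tendsto' (tendsto_laplaceTransform_pow_mul hr hx (hf r hrs) hfx) fun n => ?_
  have hn : (0 : ℝ) ≤ n / x := by positivity
  exact mul_nonneg (by positivity) (laplaceTransform_pow_mul_nonneg hf h n (by linarith))

end PostWidder

section SubIntensity

/-- Sub-intensity matrices, not necessarily nonsingular: nonnegative off-diagonal entries and
nonnegative exit rates. -/
structure IsSubIntensity {S : Type*} [Fintype S] (T : Matrix S S ℝ) : Prop where
  offDiag_nonneg : ∀ i j, i ≠ j → 0 ≤ T i j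
  exit_nonneg : ∀ i, 0 ≤ exitVector T i

variable {S : Type*} [Fintype S]

lemma exitVector_apply (T : Matrix S S ℝ) (i : S) : exitVector T i = -∑ j, T i j := by
  simp [exitVector, Matrix.mulVec, dotProduct]

variable [DecidableEq S] {T : Matrix S S ℝ}

lemma diagonal_sub_mulVec (d x : S → ℝ) (i : S) :
    ((diagonal d - T) *ᵥ x) i = d i * x i - ∑ j, T i j * x j := by
  rw [sub_mulVec, Pi.sub_apply, mulVec_diagonal]
  rfl

lemma IsSubIntensity.nonneg_of_mulVec_nonneg (hT : IsSubIntensity T) {d x : S → ℝ}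
    (hd : ∀ i, 0 < d i) (hx : ∀ i, 0 ≤ ((diagonal d - T) *ᵥ x) i) (i : S) : 0 ≤ x i := by
  -- A negative minimum of `x` would make the corresponding entry of `(d - T) x` negative.
  obtain ⟨m, -, hm⟩ := Finset.exists_min_image Finset.univ x ⟨i, Finset.mem_univ i⟩
  refine le_trans ?_ (hm i (Finset.mem_univ i))
  have hmin : ∑ j, T m j * x m ≤ ∑ j, T m j * x j := by
    refine Finset.sum_le_sum fun j _ => ?_
    by_cases hj : m = j
    · rw [hj]
    · exact mul_le_mul_of_nonneg_left (hm j (Finset.mem_univ j)) (hT.offDiag_nonneg m j hj)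
  have hxm := hx m
  have hexit := hT.exit_nonneg m
  rw [diagonal_sub_mulVec] at hxm
  rw [exitVector_apply] at hexit
  rw [← Finset.sum_mul] at hmin
  have hprod : 0 ≤ (d m - ∑ j, T m j) * x m := by linarith
  exact nonneg_of_mul_nonneg_right hprod (by linarith [hd m])

lemma IsSubIntensity.det_ne_zero (hT : IsSubIntensity T) {d : S → ℝ} (hd : ∀ i, 0 < d i) :
    (diagonal d - T).det ≠ 0 := by
  intro hdet
  obtain ⟨v, hv, hv₀⟩ := Matrix.exists_mulVec_eq_zero_iff.2 hdet
  refine hv (funext fun i => le_antisymm (neg_nonneg.1 ?_) ?_)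
  · exact hT.nonneg_of_mulVec_nonneg hd (x := -v) (fun i => by simp [mulVec_neg, hv₀]) i
  · exact hT.nonneg_of_mulVec_nonneg hd (x := v) (fun i => by simp [hv₀]) i

lemma IsSubIntensity.nonneg_of_mul_eq_one (hT : IsSubIntensity T) {c : ℝ} (hc : 0 < c)
    {A : Matrix S S ℝ} (hA : (diagonal (fun _ => c) - T) * A = 1) (i j : S) : 0 ≤ A i j := by
  refine hT.nonneg_of_mulVec_nonneg (d := fun _ => c) (fun _ => hc) (x := A.col j) (fun i => ?_) i
  have hcol : ((diagonal (fun _ => c) - T) *ᵥ A.col j) i = (1 : Matrix S S ℝ) i j := by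
    rw [← hA]
    rfl
  rw [hcol, Matrix.one_apply]
  split_ifs <;> simp

lemma mul_sum_add_sum_mul_exitVector {c : ℝ} {A : Matrix S S ℝ}
    (hA : (diagonal (fun _ => c) - T) * A = 1) (i : S) :
    c * ∑ j, A i j + ∑ j, A i j * exitVector T j = 1 := by
  have hrow : A *ᵥ ((diagonal (fun _ => c) - T) *ᵥ 1) = 1 := by
    rw [mulVec_mulVec, mul_eq_one_comm.1 hA, one_mulVec]
  have hrate : (diagonal (fun _ => c) - T) *ᵥ (1 : S → ℝ) = fun j => c + exitVector T j := by
    ext j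
    rw [diagonal_sub_mulVec, exitVector_apply]
    simp [sub_eq_add_neg]
  have hi := congrFun hrow i
  rw [hrate] at hi
  simp only [mulVec, dotProduct, mul_add, Finset.sum_add_distrib, ← Finset.sum_mul,
    Pi.one_apply] at hi
  rwa [mul_comm]

end SubIntensity

section LaplaceTransformOfNonneg

lemma integrableOn_exp_mul_inv_Gamma_mul_rpow {a s : ℝ} (ha : 0 < a) (hs : 0 < s) :
    IntegrableOn (fun u => Real.exp (-(s * u)) * ((Real.Gamma a)⁻¹ * u ^ (a - 1)))
      (Set.Ioi 0) :=
  ((integrableOn_rpow_mul_exp_neg_mul ha hs).const_mul (Real.Gamma a)⁻¹).congr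
    (.of_forall fun u => by ring)

lemma laplaceTransform_inv_Gamma_mul_rpow {a s : ℝ} (ha : 0 < a) (hs : 0 < s) :
    laplaceTransform (fun u => (Real.Gamma a)⁻¹ * u ^ (a - 1)) s = s ^ (-a) := by
  calc laplaceTransform (fun u => (Real.Gamma a)⁻¹ * u ^ (a - 1)) s
      = (Real.Gamma a)⁻¹ * ∫ u in Set.Ioi 0, u ^ (a - 1) * Real.exp (-(s * u)) := by
        rw [← integral_const_mul]
        exact integral_congr_ae (.of_forall fun u => by ring)
    _ = s ^ (-a) := by
        rw [Real.integral_rpow_mul_exp_neg_mul_Ioi ha hs, mul_comm, mul_assoc,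
          mul_inv_cancel₀ (Real.Gamma_pos_of_pos ha).ne', mul_one, one_div, Real.inv_rpow hs.le,
          Real.rpow_neg hs.le]

lemma analyticAt_laplaceTransform {f : ℝ → ℝ} {s₀ s : ℝ} (hf : Measurable f)
    (hf₀ : ∀ x > 0, 0 ≤ f x)
    (hint : ∀ s > s₀, IntegrableOn (fun x => Real.exp (-(s * x)) * f x) (Set.Ioi 0))
    (hs : s₀ < s) : AnalyticAt ℝ (laplaceTransform f) s := by
  -- The Laplace transform is the moment generating function, at `-s`, of the measure `f x dx`.
  set μ : Measure ℝ := (volume.restrict (Set.Ioi 0)).withDensity fun x => ENNReal.ofReal (f x)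
  have hfin : ∀ᵐ x ∂volume.restrict (Set.Ioi (0 : ℝ)), ENNReal.ofReal (f x) < ⊤ := by simp
  have hweight : ∀ t : ℝ, (fun x => (ENNReal.ofReal (f x)).toReal • Real.exp (t * id x))
      =ᵐ[volume.restrict (Set.Ioi (0 : ℝ))] fun x => Real.exp (-(-t * x)) * f x := fun t => by
    filter_upwards [ae_restrict_mem measurableSet_Ioi] with x hx
    rw [ENNReal.toReal_ofReal (hf₀ x hx), smul_eq_mul, mul_comm, neg_mul, neg_neg, id]
  have hinterior : Set.Iio (-s₀) ⊆ interior (integrableExpSet id μ) := by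
    refine interior_maximal (fun t ht => ?_) isOpen_Iio
    change Integrable _ _
    rw [integrable_withDensity_iff_integrable_smul' hf.ennreal_ofReal hfin,
      integrable_congr (hweight t)]
    exact hint (-t) (lt_neg_of_lt_neg ht)
  have hmgf : AnalyticAt ℝ (fun s : ℝ => mgf id μ (-s)) s :=
    (analyticAt_mgf (hinterior (neg_lt_neg hs))).comp_of_eq analyticAt_id.neg rfl
  refine hmgf.congr (.of_forall fun t => ?_)
  simp only [mgf]
  rw [integral_withDensity_eq_integral_toReal_smul hf.ennreal_ofReal hfin,
    integral_congr_ae (hweight (-t)), neg_neg, laplaceTransform]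

end LaplaceTransformOfNonneg

section Kernel

attribute [local instance] Matrix.linftyOpNormedRing Matrix.linftyOpNormedAlgebra

variable {S : Type*} [Fintype S] [DecidableEq S] {α : ℝ}

/-- The Laplace transforms of the entries of the Mittag-Leffler kernel. -/
noncomputable def kernelLaplace (α : ℝ) (T : Matrix S S ℝ) (s : ℝ) : Matrix S S ℝ :=
  of fun i j => laplaceTransform (fun x => mlKernel α T x i j) s

variable (hα : 0 < α)
include hα

lemma continuousOn_mlKernel_apply (T : Matrix S S ℝ) (i j : S) :
    ContinuousOn (fun x => mlKernel α T x i j) (Set.Ioi 0) :=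
  ((continuous_id.matrix_elem i j).comp_continuousOn (continuousOn_mittagLeffler_kernel hα hα T))

lemma measurable_mlKernel_apply (T : Matrix S S ℝ) (i j : S) :
    Measurable fun x => mlKernel α T x i j := by
  have hcont : Continuous fun c : ℝ => mittagLeffler α α (c • T) i j :=
    ((continuous_mittagLeffler hα hα).comp (continuous_id.smul continuous_const)).matrix_elem i j
  exact (by fun_prop : Measurable fun x : ℝ => x ^ (α - 1)).mul
    (hcont.measurable.comp (by fun_prop : Measurable fun x : ℝ => x ^ α))

variable {T : Matrix S S ℝ} {s : ℝ}

section LargeArgument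

variable (hs : ‖T‖ ^ α⁻¹ < s)
include hs

lemma integrableOn_mlKernel_apply_of_large (i j : S) :
    IntegrableOn (fun x => Real.exp (-(s * x)) * mlKernel α T x i j) (Set.Ioi 0) :=
  have hs₀ : 0 < s := (Real.rpow_nonneg (norm_nonneg T) _).trans_lt hs
  (Matrix.entryLinearMap ℝ ℝ i j).toContinuousLinearMap.integrable_comp
    (integrableOn_exp_smul_mittagLeffler_kernel hα hα hs₀
      ((Real.rpow_inv_lt_iff_of_pos (norm_nonneg T) hs₀.le hα).1 hs))

lemma diagonal_sub_mul_kernelLaplace_of_large :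
    (diagonal (fun _ => s ^ α) - T) * kernelLaplace α T s = 1 := by
  have hs₀ : 0 < s := (Real.rpow_nonneg (norm_nonneg T) _).trans_lt hs
  have hnorm : ‖T‖ < s ^ α := (Real.rpow_inv_lt_iff_of_pos (norm_nonneg T) hs₀.le hα).1 hs
  have hentries : kernelLaplace α T s = ∫ x in Set.Ioi 0, Real.exp (-(s * x)) •
      x ^ (α - 1) • mittagLeffler α α (x ^ α • T) := by
    ext i j
    exact (Matrix.entryLinearMap ℝ ℝ i j).toContinuousLinearMap.integral_comp_comm
      (integrableOn_exp_smul_mittagLeffler_kernel hα hα hs₀ hnorm)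
  rw [hentries, ← smul_one_eq_diagonal]
  have hresolvent := smul_one_sub_mul_integral_exp_smul_mittagLeffler_kernel hα hα hs₀ hnorm
  rw [sub_self, Real.rpow_zero, one_smul] at hresolvent
  exact hresolvent

lemma hasDerivAt_kernelLaplace :
    HasDerivAt (kernelLaplace α T)
      (-(α * s ^ (α - 1)) • (kernelLaplace α T s * kernelLaplace α T s)) s := by
  have hs₀ : 0 < s := (Real.rpow_nonneg (norm_nonneg T) _).trans_lt hs
  have hunit := diagonal_sub_mul_kernelLaplace_of_large hα hs
  rw [← smul_one_eq_diagonal] at hunit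
  have hinv : kernelLaplace α T =ᶠ[nhds s] fun u => Ring.inverse (u ^ α • 1 - T) := by
    filter_upwards [Ioi_mem_nhds hs] with u hu
    have hu1 := diagonal_sub_mul_kernelLaplace_of_large hα hu
    rw [← nonsing_inv_eq_ringInverse, Matrix.smul_one_eq_diagonal, inv_eq_right_inv hu1]
  have hpow : HasDerivAt (fun u : ℝ => u ^ α • (1 : Matrix S S ℝ) - T)
      ((α * s ^ (α - 1)) • 1) s :=
    ((Real.hasDerivAt_rpow_const (Or.inl hs₀.ne')).smul_const _).sub_const T
  refine HasDerivAt.congr_of_eventuallyEq ?_ hinv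
  refine ((hasFDerivAt_ringInverse ⟨_, kernelLaplace α T s, hunit,
    mul_eq_one_comm.1 hunit⟩).comp_hasDerivAt s hpow).congr_deriv ?_
  simp

lemma hasDerivAt_kernelLaplace_apply (i j : S) :
    HasDerivAt (fun s => kernelLaplace α T s i j)
      (-∑ l, α * s ^ (α - 1) * (kernelLaplace α T s i l * kernelLaplace α T s l j)) s := by
  have hentry := (Matrix.entryLinearMap ℝ ℝ i j).toContinuousLinearMap.hasFDerivAt.comp_hasDerivAt s
    (hasDerivAt_kernelLaplace hα hs)
  refine hentry.congr_deriv ?_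
  simp only [← Finset.mul_sum, ← mul_apply]
  exact neg_mul _ _

lemma integrableOn_rpow_sub_sum_mlKernel_of_large (i : S) :
    IntegrableOn (fun u => Real.exp (-(s * u)) *
      ((Real.Gamma α)⁻¹ * u ^ (α - 1) - ∑ j, mlKernel α T u i j)) (Set.Ioi 0) := by
  have hs₀ : 0 < s := (Real.rpow_nonneg (norm_nonneg T) _).trans_lt hs
  simp only [mul_sub, Finset.mul_sum]
  exact (integrableOn_exp_mul_inv_Gamma_mul_rpow hα hs₀).sub
    (integrable_finsetSum _ fun j _ => integrableOn_mlKernel_apply_of_large hα hs i j)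

lemma laplaceTransform_rpow_sub_sum_mlKernel_of_large (i : S) :
    laplaceTransform (fun u => (Real.Gamma α)⁻¹ * u ^ (α - 1) - ∑ j, mlKernel α T u i j) s =
      s ^ (-α) * ∑ j, kernelLaplace α T s i j * exitVector T j := by
  have hs₀ : 0 < s := (Real.rpow_nonneg (norm_nonneg T) _).trans_lt hs
  have hrow := mul_sum_add_sum_mul_exitVector (diagonal_sub_mul_kernelLaplace_of_large hα hs) i
  have hint : ∀ j, Integrable (fun u => Real.exp (-(s * u)) * mlKernel α T u i j)
      (volume.restrict (Set.Ioi 0)) := integrableOn_mlKernel_apply_of_large hα hs i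
  calc laplaceTransform (fun u => (Real.Gamma α)⁻¹ * u ^ (α - 1) - ∑ j, mlKernel α T u i j) s
      = laplaceTransform (fun u => (Real.Gamma α)⁻¹ * u ^ (α - 1)) s -
          ∑ j, kernelLaplace α T s i j := by
        simp only [laplaceTransform, mul_sub, Finset.mul_sum]
        rw [integral_sub (integrableOn_exp_mul_inv_Gamma_mul_rpow hα hs₀)
          (integrable_finsetSum _ fun j _ => hint j), integral_finsetSum _ fun j _ => hint j]
        rfl
    _ = s ^ (-α) * ∑ j, kernelLaplace α T s i j * exitVector T j := by
        rw [laplaceTransform_inv_Gamma_mul_rpow hα hs₀, eq_sub_of_add_eq' hrow,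
          Real.rpow_neg hs₀.le]
        field_simp

end LargeArgument

section SubIntensity

variable (hα' : α ≤ 1) (hT : IsSubIntensity T)
include hα' hT

lemma IsSubIntensity.completelyMonotoneUpTo_kernelLaplace (n : ℕ) (i j : S) :
    CompletelyMonotoneUpTo (‖T‖ ^ α⁻¹) n fun s => kernelLaplace α T s i j := by
  have hs₀ : 0 ≤ ‖T‖ ^ α⁻¹ := Real.rpow_nonneg (norm_nonneg T) _
  have hnonneg : ∀ s > ‖T‖ ^ α⁻¹, ∀ i j, 0 ≤ kernelLaplace α T s i j := fun s hs i j =>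
    hT.nonneg_of_mul_eq_one (Real.rpow_pos_of_pos (hs₀.trans_lt hs) α)
      (diagonal_sub_mul_kernelLaplace_of_large hα hs) i j
  induction n generalizing i j with
  | zero => exact fun s hs => hnonneg s hs i j
  | succ n ih =>
    exact ⟨fun s hs => hnonneg s hs i j, _,
      fun s hs => hasDerivAt_kernelLaplace_apply hα hs i j,
      .sum Finset.univ fun l => ((CompletelyMonotoneUpTo.const hα.le).mul
        (.rpow hs₀ (sub_nonpos.2 hα'))).mul ((ih i l).mul (ih l j))⟩

lemma IsSubIntensity.mlKernel_nonneg {x : ℝ} (hx : 0 < x) (i j : S) : 0 ≤ mlKernel α T x i j :=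
  nonneg_of_completelyMonotone_laplaceTransform (f := fun x => mlKernel α T x i j)
    ((continuousOn_mlKernel_apply hα T i j).continuousAt (Ioi_mem_nhds hx))
    (fun _ hs => integrableOn_mlKernel_apply_of_large hα hs i j)
    (fun n => hT.completelyMonotoneUpTo_kernelLaplace hα hα' n i j) hx

lemma IsSubIntensity.sum_mlKernel_le {x : ℝ} (hx : 0 < x) (i : S) :
    ∑ j, mlKernel α T x i j ≤ (Real.Gamma α)⁻¹ * x ^ (α - 1) := by
  have hs₀ : 0 ≤ ‖T‖ ^ α⁻¹ := Real.rpow_nonneg (norm_nonneg T) _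
  refine sub_nonneg.1 (nonneg_of_completelyMonotone_laplaceTransform (s₀ := ‖T‖ ^ α⁻¹)
    (f := fun x => (Real.Gamma α)⁻¹ * x ^ (α - 1) - ∑ j, mlKernel α T x i j) ?_ ?_ ?_ hx)
  · refine ((Real.continuousAt_rpow_const x _ (Or.inl hx.ne')).const_mul _).sub
      (tendsto_finsetSum _ fun j _ => ?_)
    exact (continuousOn_mlKernel_apply hα T i j).continuousAt (Ioi_mem_nhds hx)
  · exact fun s hs => integrableOn_rpow_sub_sum_mlKernel_of_large hα hs i
  · exact fun n => ((CompletelyMonotoneUpTo.rpow hs₀ (neg_nonpos.2 hα.le)).mul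
      (.sum Finset.univ fun j => (hT.completelyMonotoneUpTo_kernelLaplace hα hα' n i j).mul
        (.const (hT.exit_nonneg j)))).congr fun s hs =>
        (laplaceTransform_rpow_sub_sum_mlKernel_of_large hα hs i).symm

lemma IsSubIntensity.mlKernel_le {x : ℝ} (hx : 0 < x) (i j : S) :
    mlKernel α T x i j ≤ (Real.Gamma α)⁻¹ * x ^ (α - 1) :=
  (Finset.single_le_sum (f := fun j => mlKernel α T x i j)
    (fun j _ => hT.mlKernel_nonneg hα hα' hx i j) (Finset.mem_univ j)).trans
    (hT.sum_mlKernel_le hα hα' hx i)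

variable (hs : 0 < s)
include hs

lemma IsSubIntensity.integrableOn_mlKernel (i j : S) :
    IntegrableOn (fun x => Real.exp (-(s * x)) * mlKernel α T x i j) (Set.Ioi 0) := by
  refine (integrableOn_exp_mul_inv_Gamma_mul_rpow hα hs).mono'
    ((by fun_prop : Measurable fun x : ℝ => Real.exp (-(s * x))).mul
      (measurable_mlKernel_apply hα T i j)).aestronglyMeasurable ?_
  filter_upwards [ae_restrict_mem measurableSet_Ioi] with x hx
  have hnonneg := hT.mlKernel_nonneg hα hα' hx i j
  rw [Real.norm_of_nonneg (by positivity)]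
  gcongr
  exact hT.mlKernel_le hα hα' hx i j

/-- The identity is analytic in `s` and holds for large `s`. -/
lemma IsSubIntensity.diagonal_sub_mul_kernelLaplace :
    (diagonal (fun _ => s ^ α) - T) * kernelLaplace α T s = 1 := by
  have hs₀ : 0 ≤ ‖T‖ ^ α⁻¹ := Real.rpow_nonneg (norm_nonneg T) _
  have hentry : ∀ u i j,
      ((diagonal (fun _ => u ^ α) - T) * kernelLaplace α T u : Matrix S S ℝ) i j =
        u ^ α * kernelLaplace α T u i j - ∑ l, T i l * kernelLaplace α T u l j := fun u i j => by
    rw [Matrix.sub_mul, Matrix.sub_apply, diagonal_mul, mul_apply]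
  have hanalytic : ∀ u > 0, ∀ i j, AnalyticAt ℝ (fun u => kernelLaplace α T u i j) u :=
    fun u hu i j => analyticAt_laplaceTransform (measurable_mlKernel_apply hα T i j)
      (fun x hx => hT.mlKernel_nonneg hα hα' hx i j)
      (fun v hv => hT.integrableOn_mlKernel hα hα' hv i j) hu
  ext i j
  have hentry_analytic : AnalyticOnNhd ℝ (fun u => u ^ α * kernelLaplace α T u i j -
      ∑ l, T i l * kernelLaplace α T u l j) (Set.Ioi 0) := fun u hu =>
    ((Real.contDiffAt_rpow_const_of_ne (ne_of_gt hu)).analyticAt.mul (hanalytic u hu i j)).sub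
      (Finset.analyticAt_fun_sum _ fun l _ => analyticAt_const.mul (hanalytic u hu l j))
  have hlarge : ‖T‖ ^ α⁻¹ < ‖T‖ ^ α⁻¹ + 1 := lt_add_one _
  rw [hentry]
  refine hentry_analytic.eqOn_of_preconnected_of_eventuallyEq
    (g := fun _ => (1 : Matrix S S ℝ) i j) analyticOnNhd_const isPreconnected_Ioi
    (hs₀.trans_lt hlarge) ?_ hs
  filter_upwards [Ioi_mem_nhds hlarge] with u hu
  rw [← hentry, diagonal_sub_mul_kernelLaplace_of_large hα hu]

lemma IsSubIntensity.kernelLaplace_nonneg (i j : S) : 0 ≤ kernelLaplace α T s i j :=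
  hT.nonneg_of_mul_eq_one (Real.rpow_pos_of_pos hs α)
    (hT.diagonal_sub_mul_kernelLaplace hα hα' hs) i j

end SubIntensity

section BilinearForm

variable {a b : S → ℝ}

lemma measurable_dotProduct_mlKernel :
    Measurable fun x => a ⬝ᵥ (mlKernel α T x *ᵥ b) := by
  simp only [dotProduct, mulVec]
  exact Finset.measurable_fun_sum _ fun i _ => (Finset.measurable_fun_sum _ fun j _ =>
    (measurable_mlKernel_apply hα T i j).mul_const _).const_mul _

variable (hα' : α ≤ 1) (hT : IsSubIntensity T) (ha : ∀ i, 0 ≤ a i) (hb : ∀ i, 0 ≤ b i)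
include hα' hT

lemma IsSubIntensity.integrableOn_dotProduct_mlKernel (hs : 0 < s) : IntegrableOn
    (fun x => Real.exp (-(s * x)) * (a ⬝ᵥ (mlKernel α T x *ᵥ b))) (Set.Ioi 0) := by
  simp only [dotProduct, mulVec, Finset.mul_sum]
  refine integrable_finsetSum _ fun i _ => integrable_finsetSum _ fun j _ => ?_
  refine ((hT.integrableOn_mlKernel hα hα' hs i j).const_mul (a i * b j)).congr
    (.of_forall fun x => ?_)
  ring

lemma IsSubIntensity.laplaceTransform_dotProduct_mlKernel (hs : 0 < s) :
    laplaceTransform (fun x => a ⬝ᵥ (mlKernel α T x *ᵥ b)) s =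
      a ⬝ᵥ (kernelLaplace α T s *ᵥ b) := by
  have hint : ∀ i j, Integrable (fun x => a i * b j * (Real.exp (-(s * x)) * mlKernel α T x i j))
      (volume.restrict (Set.Ioi 0)) := fun i j =>
    (hT.integrableOn_mlKernel hα hα' hs i j).const_mul _
  calc laplaceTransform (fun x => a ⬝ᵥ (mlKernel α T x *ᵥ b)) s
      = ∫ x in Set.Ioi 0, ∑ i, ∑ j, a i * b j * (Real.exp (-(s * x)) * mlKernel α T x i j) := by
        refine integral_congr_ae (.of_forall fun x => ?_)
        simp only [dotProduct, mulVec, Finset.mul_sum]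
        exact Finset.sum_congr rfl fun i _ => Finset.sum_congr rfl fun j _ => by ring
    _ = ∑ i, ∑ j, a i * b j * kernelLaplace α T s i j := by
        rw [integral_finsetSum _ fun i _ => integrable_finsetSum _ fun j _ => hint i j]
        refine Finset.sum_congr rfl fun i _ => ?_
        rw [integral_finsetSum _ fun j _ => hint i j]
        exact Finset.sum_congr rfl fun j _ => integral_const_mul _ _
    _ = a ⬝ᵥ (kernelLaplace α T s *ᵥ b) := by
        simp only [dotProduct, mulVec, Finset.mul_sum]
        exact Finset.sum_congr rfl fun i _ => Finset.sum_congr rfl fun j _ => by ring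

include ha hb

lemma IsSubIntensity.dotProduct_mlKernel_nonneg {x : ℝ} (hx : 0 < x) :
    0 ≤ a ⬝ᵥ (mlKernel α T x *ᵥ b) :=
  dotProduct_nonneg_of_nonneg ha fun i => dotProduct_nonneg_of_nonneg
    (fun j => hT.mlKernel_nonneg hα hα' hx i j) hb

lemma IsSubIntensity.lintegral_mlKernel (hs : 0 < s) :
    ∫⁻ x in Set.Ioi 0, ENNReal.ofReal (Real.exp (-(s * x)) * (a ⬝ᵥ (mlKernel α T x *ᵥ b))) =
      ENNReal.ofReal (a ⬝ᵥ (kernelLaplace α T s *ᵥ b)) := by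
  rw [← hT.laplaceTransform_dotProduct_mlKernel hα hα' hs, laplaceTransform,
    ofReal_integral_eq_lintegral_ofReal (hT.integrableOn_dotProduct_mlKernel hα hα' hs)]
  filter_upwards [ae_restrict_mem measurableSet_Ioi] with x hx
  exact mul_nonneg (Real.exp_nonneg _) (hT.dotProduct_mlKernel_nonneg hα hα' ha hb hx)

end BilinearForm

end Kernel

section Uniqueness

open scoped NNReal BoundedContinuousFunction

variable {ι : Type*} [Fintype ι]

/-- The function `exp (-⟨z, θ⟩)` on the orthant. -/
noncomputable def expChar (θ : ι → ℝ≥0) : (ι → ℝ≥0) →ᵇ ℝ :=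
  BoundedContinuousFunction.ofNormedAddCommGroup
    (fun z => Real.exp (-∑ k, (z k : ℝ) * θ k)) (by fun_prop) 1 fun z => by
      rw [Real.norm_of_nonneg (Real.exp_nonneg _), Real.exp_le_one_iff, neg_nonpos]
      positivity

lemma expChar_apply (θ z : ι → ℝ≥0) : expChar θ z = Real.exp (-∑ k, (z k : ℝ) * θ k) := rfl

lemma expChar_zero : expChar (0 : ι → ℝ≥0) = 1 := by
  ext z
  simp [expChar_apply]

lemma expChar_add (θ θ' : ι → ℝ≥0) : expChar (θ + θ') = expChar θ * expChar θ' := by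
  ext z
  simp only [expChar_apply, BoundedContinuousFunction.coe_mul, Pi.mul_apply, Pi.add_apply,
    NNReal.coe_add, mul_add, Finset.sum_add_distrib, neg_add, Real.exp_add]

/-- The functions `exp (-⟨z, θ⟩)` as a homomorphism in `θ`; its range spans the algebra to which the
Stone-Weierstrass theorem is applied. -/
noncomputable def expCharHom (ι : Type*) [Fintype ι] :
    Multiplicative (ι → ℝ≥0) →* ((ι → ℝ≥0) →ᵇ ℝ) where
  toFun θ := expChar θ.toAdd
  map_one' := expChar_zero
  map_mul' θ θ' := expChar_add θ.toAdd θ'.toAdd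

/-- The algebra generated by the functions `exp (-⟨z, θ⟩)`. -/
noncomputable def expCharAlgebra (ι : Type*) [Fintype ι] :
    StarSubalgebra ℝ ((ι → ℝ≥0) →ᵇ ℝ) where
  toSubalgebra := Algebra.adjoin ℝ (MonoidHom.mrange (expCharHom ι))
  star_mem' {a} ha := by
    have hstar : star a = a := by
      ext z
      simp
    exact hstar ▸ ha

lemma exists_expChar_ne {x y : ι → ℝ≥0} (hxy : x ≠ y) :
    ∃ θ, expChar θ x ≠ expChar θ y := by
  classical
  obtain ⟨k, hk⟩ := Function.ne_iff.1 hxy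
  exact ⟨Pi.single k 1, by simpa [expChar_apply, Pi.single_apply, apply_ite] using hk⟩

lemma measure_ext_of_integral_expChar {μ ν : Measure (ι → ℝ≥0)} [IsFiniteMeasure μ]
    [IsFiniteMeasure ν] (h : ∀ θ, ∫ z, expChar θ z ∂μ = ∫ z, expChar θ z ∂ν) : μ = ν := by
  refine ext_of_forall_mem_subalgebra_integral_eq_of_polish (𝕜 := ℝ) (A := expCharAlgebra ι) ?_ ?_
  · intro x y hxy
    obtain ⟨θ, hθ⟩ := exists_expChar_ne hxy
    exact ⟨_, ⟨_, ⟨expChar θ, Algebra.subset_adjoin ⟨Multiplicative.ofAdd θ, rfl⟩, rfl⟩, rfl⟩, hθ⟩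
  · intro g hg
    have hspan : g ∈ Subalgebra.toSubmodule (Algebra.adjoin ℝ
        (MonoidHom.mrange (expCharHom ι) : Set ((ι → ℝ≥0) →ᵇ ℝ))) := hg
    rw [Algebra.adjoin_eq_span, Submonoid.closure_eq] at hspan
    clear hg
    induction hspan using Submodule.span_induction with
    | mem g hg =>
      obtain ⟨θ, rfl⟩ := hg
      exact h _
    | zero => simp
    | add f g _ _ hf hg =>
      simp only [BoundedContinuousFunction.coe_add, Pi.add_apply]
      rw [integral_add (f.integrable _) (g.integrable _),
        integral_add (f.integrable _) (g.integrable _), hf, hg]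
    | smul c f _ hf =>
      simp only [BoundedContinuousFunction.coe_smul]
      rw [integral_smul, integral_smul, hf]

/-- The weight `exp (-⟨y, e⟩)`, for which a measure with a finite Laplace transform on the interior
of the orthant becomes finite. -/
noncomputable def tiltWeight (y : ι → ℝ) : ENNReal := ENNReal.ofReal (Real.exp (-(y ⬝ᵥ 1)))

/-- The tilted measure `exp (-⟨y, e⟩) μ(dy)` of a measure concentrated on the orthant, as a measure
on `ℝ≥0` vectors. -/
noncomputable def orthantTilt (μ : Measure (ι → ℝ)) : Measure (ι → ℝ≥0) :=
  (μ.withDensity tiltWeight).map fun y k => (y k).toNNReal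

lemma measurable_tiltWeight : Measurable (tiltWeight : (ι → ℝ) → ENNReal) := by
  unfold tiltWeight dotProduct
  fun_prop

variable {μ ν : Measure (ι → ℝ)} (hμ : ∀ᵐ y ∂μ, ∀ k, 0 ≤ y k)
include hμ

lemma lintegral_expChar_orthantTilt (θ : ι → ℝ≥0) :
    ∫⁻ z, ENNReal.ofReal (expChar θ z) ∂orthantTilt μ =
      ∫⁻ y, ENNReal.ofReal (Real.exp (-(y ⬝ᵥ fun k => (θ k : ℝ) + 1))) ∂μ := by
  have hexpChar : Measurable fun z => ENNReal.ofReal (expChar θ z) :=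
    (expChar θ).continuous.measurable.ennreal_ofReal
  have htoNNReal : Measurable fun (y : ι → ℝ) k => (y k).toNNReal := by fun_prop
  rw [orthantTilt, lintegral_map hexpChar htoNNReal]
  refine (lintegral_withDensity_eq_lintegral_mul _ measurable_tiltWeight
    (hexpChar.comp htoNNReal)).trans (lintegral_congr_ae ?_)
  filter_upwards [hμ] with y hy
  simp only [Pi.mul_apply, Function.comp_apply, tiltWeight, expChar_apply]
  rw [← ENNReal.ofReal_mul (Real.exp_nonneg _), ← Real.exp_add]
  congr 2
  simp only [dotProduct, mul_add, Finset.sum_add_distrib, Pi.one_apply, mul_one,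
    Real.coe_toNNReal _ (hy _)]
  ring

lemma isFiniteMeasure_orthantTilt
    (hfin : ∫⁻ y, ENNReal.ofReal (Real.exp (-(y ⬝ᵥ 1))) ∂μ ≠ ⊤) :
    IsFiniteMeasure (orthantTilt μ) := by
  refine ⟨lt_top_iff_ne_top.2 ?_⟩
  have hmass := lintegral_expChar_orthantTilt hμ 0
  simp only [expChar_zero, BoundedContinuousFunction.coe_one, Pi.one_apply, ENNReal.ofReal_one,
    lintegral_one, Pi.zero_apply, NNReal.coe_zero, zero_add] at hmass
  rw [hmass]
  exact hfin

lemma withDensity_inv_map_orthantTilt :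
    ((orthantTilt μ).map fun z k => (z k : ℝ)).withDensity (fun y => (tiltWeight y)⁻¹) = μ := by
  rw [orthantTilt, Measure.map_map (by fun_prop) (by fun_prop), Measure.map_congr (g := id),
    Measure.map_id]
  · exact withDensity_inv_same measurable_tiltWeight
      (.of_forall fun y => by simp [tiltWeight, Real.exp_pos])
      (.of_forall fun y => by simp [tiltWeight])
  · filter_upwards [(withDensity_absolutelyContinuous μ _).ae_le hμ] with y hy
      using funext fun k => Real.coe_toNNReal _ (hy k)

lemma measure_ext_of_laplace (hν : ∀ᵐ y ∂ν, ∀ k, 0 ≤ y k)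
    (h : ∀ θ : ι → ℝ, (∀ k, 0 < θ k) → ∫⁻ y, ENNReal.ofReal (Real.exp (-(y ⬝ᵥ θ))) ∂μ =
      ∫⁻ y, ENNReal.ofReal (Real.exp (-(y ⬝ᵥ θ))) ∂ν)
    (hfin : ∫⁻ y, ENNReal.ofReal (Real.exp (-(y ⬝ᵥ 1))) ∂μ ≠ ⊤) : μ = ν := by
  have hfinμ := isFiniteMeasure_orthantTilt hμ hfin
  have hfinν := isFiniteMeasure_orthantTilt hν (h 1 (fun _ => one_pos) ▸ hfin)
  have hnonneg : ∀ θ z : ι → ℝ≥0, 0 ≤ expChar θ z := fun θ z => Real.exp_nonneg _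
  have htilt : orthantTilt μ = orthantTilt ν := by
    refine measure_ext_of_integral_expChar fun θ => ?_
    rw [integral_eq_lintegral_of_nonneg_ae (.of_forall (hnonneg θ))
      (expChar θ).continuous.aestronglyMeasurable,
      integral_eq_lintegral_of_nonneg_ae (.of_forall (hnonneg θ))
      (expChar θ).continuous.aestronglyMeasurable,
      lintegral_expChar_orthantTilt hμ, lintegral_expChar_orthantTilt hν, h]
    exact fun k => by positivity
  rw [← withDensity_inv_map_orthantTilt hμ, htilt, withDensity_inv_map_orthantTilt hν]

end Uniqueness

section Piecewise

lemma setLIntegral_prod_lt {G : ℝ × ℝ → ENNReal} (hG : Measurable G) :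
    ∫⁻ z in {z : ℝ × ℝ | 0 < z.1 ∧ z.1 < z.2}, G z =
      ∫⁻ u in Set.Ioi (0 : ℝ), ∫⁻ v in Set.Ioi (0 : ℝ), G (u, u + v) := by
  have hs : MeasurableSet {z : ℝ × ℝ | 0 < z.1 ∧ z.1 < z.2} := by measurability
  rw [← lintegral_indicator hs, Measure.volume_eq_prod,
    lintegral_prod _ (hG.indicator hs).aemeasurable, ← lintegral_indicator measurableSet_Ioi]
  refine lintegral_congr fun u => ?_
  rw [← lintegral_add_right_eq_self _ u]
  by_cases hu : 0 < u
  · rw [Set.indicator_of_mem (Set.mem_Ioi.2 hu), ← lintegral_indicator measurableSet_Ioi]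
    refine lintegral_congr fun v => ?_
    by_cases hv : 0 < v <;> simp [Set.indicator, hu, hv, add_comm]
  · simp [Set.indicator, hu]

lemma setLIntegral_zero_lt_one {G : (Fin 2 → ℝ) → ENNReal} (hG : Measurable G) :
    ∫⁻ z in {z : Fin 2 → ℝ | 0 < z 0 ∧ z 0 < z 1}, G z =
      ∫⁻ u in Set.Ioi (0 : ℝ), ∫⁻ v in Set.Ioi (0 : ℝ), G ![u, u + v] := by
  have hpair : MeasurePreserving fun z : ℝ × ℝ => (![z.1, z.2] : Fin 2 → ℝ) :=
    (volume_preserving_finTwoArrow ℝ).symm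
  rw [← hpair.setLIntegral_comp_preimage (by measurability) hG]
  exact setLIntegral_prod_lt (hG.comp hpair.measurable)

lemma setLIntegral_one_lt_zero {G : (Fin 2 → ℝ) → ENNReal} (hG : Measurable G) :
    ∫⁻ z in {z : Fin 2 → ℝ | 0 < z 1 ∧ z 1 < z 0}, G z =
      ∫⁻ u in Set.Ioi (0 : ℝ), ∫⁻ v in Set.Ioi (0 : ℝ), G ![u + v, u] := by
  have hpair : MeasurePreserving fun z : ℝ × ℝ => (![z.2, z.1] : Fin 2 → ℝ) :=
    (volume_preserving_finTwoArrow ℝ).symm.comp Measure.measurePreserving_swap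
  rw [← hpair.setLIntegral_comp_preimage (by measurability) hG]
  exact setLIntegral_prod_lt (hG.comp hpair.measurable)

lemma lintegral_map_withDensity_ofReal {X : Type*} [MeasurableSpace X] {m : ℝ → X} {d : ℝ → ℝ}
    {G : X → ENNReal} (hm : Measurable m) (hd : Measurable d) (hG : Measurable G) (s : Set ℝ) :
    ∫⁻ z, G z ∂((volume.restrict s).withDensity fun x => ENNReal.ofReal (d x)).map m =
      ∫⁻ x in s, ENNReal.ofReal (d x) * G (m x) := by
  rw [lintegral_map hG hm]
  exact lintegral_withDensity_eq_lintegral_mul _ hd.ennreal_ofReal (hG.comp hm)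

lemma lintegral_piecewiseMeasure {f₁ f₂ : ℝ → ℝ → ℝ} {g h₁ h₂ : ℝ → ℝ} (c : ℝ)
    (hf₁ : Measurable fun z : Fin 2 → ℝ => f₁ (z 0) (z 1))
    (hf₂ : Measurable fun z : Fin 2 → ℝ => f₂ (z 0) (z 1))
    (hg : Measurable g) (hh₁ : Measurable h₁) (hh₂ : Measurable h₂)
    {G : (Fin 2 → ℝ) → ENNReal} (hG : Measurable G) :
    ∫⁻ z, G z ∂piecewiseMeasure f₁ f₂ g h₁ h₂ c =
      (∫⁻ u in Set.Ioi (0 : ℝ), ∫⁻ v in Set.Ioi (0 : ℝ),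
        ENNReal.ofReal (f₁ (u + v) u) * G ![u + v, u]) +
      (∫⁻ u in Set.Ioi (0 : ℝ), ∫⁻ v in Set.Ioi (0 : ℝ),
        ENNReal.ofReal (f₂ u (u + v)) * G ![u, u + v]) +
      (∫⁻ x in Set.Ioi (0 : ℝ), ENNReal.ofReal (g x) * G ![x, x]) +
      (∫⁻ x in Set.Ioi (0 : ℝ), ENNReal.ofReal (h₁ x) * G ![x, 0]) +
      (∫⁻ x in Set.Ioi (0 : ℝ), ENNReal.ofReal (h₂ x) * G ![0, x]) +
      ENNReal.ofReal c * G 0 := by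
  simp only [piecewiseMeasure, lintegral_add_measure, lintegral_smul_measure]
  rw [lintegral_dirac' _ hG, lintegral_map_withDensity_ofReal (by fun_prop) hg hG,
    lintegral_map_withDensity_ofReal (by fun_prop) hh₁ hG,
    lintegral_map_withDensity_ofReal (by fun_prop) hh₂ hG,
    lintegral_withDensity_eq_lintegral_mul _ hf₁.ennreal_ofReal hG,
    lintegral_withDensity_eq_lintegral_mul _ hf₂.ennreal_ofReal hG,
    setLIntegral_one_lt_zero (hf₁.ennreal_ofReal.mul hG),
    setLIntegral_zero_lt_one (hf₂.ennreal_ofReal.mul hG)]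
  rfl

lemma ae_withDensity_restrict_of_forall {X : Type*} [MeasurableSpace X] {μ : Measure X}
    {s : Set X} (hs : MeasurableSet s) {p : X → Prop} (hp : ∀ x ∈ s, p x) (d : X → ENNReal) :
    ∀ᵐ x ∂(μ.restrict s).withDensity d, p x :=
  (withDensity_absolutelyContinuous _ _).ae_le (ae_restrict_of_forall_mem hs hp)

lemma piecewiseMeasure_nonneg (f₁ f₂ : ℝ → ℝ → ℝ) (g h₁ h₂ : ℝ → ℝ) (c : ℝ) :
    ∀ᵐ z ∂piecewiseMeasure f₁ f₂ g h₁ h₂ c, ∀ k, 0 ≤ z k := by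
  have hs : MeasurableSet {z : Fin 2 → ℝ | 0 ≤ z 0 ∧ 0 ≤ z 1} := by measurability
  have hmap : ∀ {m : ℝ → Fin 2 → ℝ} (d : ℝ → ENNReal), Measurable m →
      (∀ x > 0, 0 ≤ m x 0 ∧ 0 ≤ m x 1) →
      ∀ᵐ z ∂((volume.restrict (Set.Ioi 0)).withDensity d).map m, 0 ≤ z 0 ∧ 0 ≤ z 1 :=
    fun d hm hnonneg => (ae_map_iff hm.aemeasurable hs).2
      (ae_withDensity_restrict_of_forall measurableSet_Ioi hnonneg d)
  simp only [piecewiseMeasure, ae_add_measure_iff, Fin.forall_fin_two]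
  refine ⟨⟨⟨⟨⟨?_, ?_⟩, ?_⟩, ?_⟩, ?_⟩, ?_⟩
  · exact ae_withDensity_restrict_of_forall (by measurability)
      (fun z hz => ⟨(hz.1.trans hz.2).le, hz.1.le⟩) _
  · exact ae_withDensity_restrict_of_forall (by measurability)
      (fun z hz => ⟨hz.1.le, (hz.1.trans hz.2).le⟩) _
  · exact hmap _ (by fun_prop) fun x hx => ⟨hx.le, hx.le⟩
  · exact hmap _ (by fun_prop) fun x hx => ⟨hx.le, le_rfl⟩
  · exact hmap _ (by fun_prop) fun x hx => ⟨le_rfl, hx.le⟩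
  · refine Measure.ae_smul_measure ?_ _
    rw [ae_dirac_iff hs]
    simp

end Piecewise

lemma mulVec_nonneg {m n : Type*} [Fintype n] {A : Matrix m n ℝ} {v : n → ℝ}
    (hA : ∀ i j, 0 ≤ A i j) (hv : ∀ j, 0 ≤ v j) (i : m) : 0 ≤ (A *ᵥ v) i :=
  dotProduct_nonneg_of_nonneg (hA i) hv

lemma mulVec_mulVec_of_mul_eq_one {n : Type*} [Fintype n] [DecidableEq n] {A B : Matrix n n ℝ}
    (h : A * B = 1) (v : n → ℝ) : A *ᵥ (B *ᵥ v) = v := by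
  rw [mulVec_mulVec, h, one_mulVec]

section Densities

variable {p q : ℕ} {α : ℝ} (hα : 0 < α) {T : Matrix (Fin p) (Fin p) ℝ}
  {T' : Matrix (Fin q) (Fin q) ℝ} {π t : Fin p → ℝ} {t' : Fin q → ℝ} {D : Matrix (Fin p) (Fin q) ℝ}
include hα

lemma measurable_lineDensity : Measurable (lineDensity α π T t) := measurable_dotProduct_mlKernel hα

lemma measurable_planeDensity {X : Type*} [MeasurableSpace X] {f g : X → ℝ} (hf : Measurable f)
    (hg : Measurable g) : Measurable fun z => planeDensity α π T D T' t' (f z) (g z) := by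
  simp only [planeDensity, dotProduct, mulVec, Matrix.mul_apply]
  have hkernel : ∀ i j, Measurable fun z => mlKernel α T (f z) i j := fun i j =>
    (measurable_mlKernel_apply hα T i j).comp hf
  have hkernel' : ∀ i j, Measurable fun z => mlKernel α T' (g z) i j := fun i j =>
    (measurable_mlKernel_apply hα T' i j).comp hg
  fun_prop

variable (hα' : α ≤ 1) (hT : IsSubIntensity T) (hπ : ∀ i, 0 ≤ π i)
include hα' hT hπ

section Line

variable (ht : ∀ i, 0 ≤ t i)
include ht

lemma lineDensity_nonneg {x : ℝ} (hx : 0 < x) : 0 ≤ lineDensity α π T t x :=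
  hT.dotProduct_mlKernel_nonneg hα hα' hπ ht hx

lemma lintegral_lineDensity {s : ℝ} (hs : 0 < s) :
    ∫⁻ x in Set.Ioi (0 : ℝ), ENNReal.ofReal (lineDensity α π T t x) *
      ENNReal.ofReal (Real.exp (-(s * x))) = ENNReal.ofReal (π ⬝ᵥ (kernelLaplace α T s *ᵥ t)) := by
  rw [← hT.lintegral_mlKernel hα hα' hπ ht hs]
  refine lintegral_congr fun x => ?_
  rw [mul_comm, ← ENNReal.ofReal_mul (by positivity)]
  rfl

end Line

lemma vecMul_mlKernel_mul_nonneg (hD : ∀ i j, 0 ≤ D i j) {u : ℝ} (hu : 0 < u) (j : Fin q) :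
    0 ≤ (π ᵥ* (mlKernel α T u * D)) j := by
  simp only [vecMul, dotProduct, Matrix.mul_apply]
  exact Finset.sum_nonneg fun i _ => mul_nonneg (hπ i)
    (Finset.sum_nonneg fun l _ => mul_nonneg (hT.mlKernel_nonneg hα hα' hu i l) (hD l j))

omit hα hα' hT hπ in
lemma planeDensity_eq (u v : ℝ) :
    planeDensity α π T D T' t' u v = (π ᵥ* (mlKernel α T u * D)) ⬝ᵥ (mlKernel α T' v *ᵥ t') := by
  rw [planeDensity, ← mulVec_mulVec, dotProduct_mulVec]

variable (hT' : IsSubIntensity T') (hD : ∀ i j, 0 ≤ D i j) (ht' : ∀ i, 0 ≤ t' i)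
include hT' hD ht'

lemma planeDensity_nonneg {u v : ℝ} (hu : 0 < u) (hv : 0 < v) :
    0 ≤ planeDensity α π T D T' t' u v := by
  rw [planeDensity_eq]
  exact hT'.dotProduct_mlKernel_nonneg hα hα'
    (vecMul_mlKernel_mul_nonneg hα hα' hT hπ hD hu) ht' hv

lemma lintegral_planeDensity {s r : ℝ} (hs : 0 < s) (hr : 0 < r) :
    ∫⁻ u in Set.Ioi (0 : ℝ), ∫⁻ v in Set.Ioi (0 : ℝ),
      ENNReal.ofReal (planeDensity α π T D T' t' u v) *
        ENNReal.ofReal (Real.exp (-(s * u + r * v))) =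
      ENNReal.ofReal (π ⬝ᵥ (kernelLaplace α T s *ᵥ (D *ᵥ (kernelLaplace α T' r *ᵥ t')))) := by
  have hinner : ∀ i, 0 ≤ (D *ᵥ (kernelLaplace α T' r *ᵥ t')) i :=
    mulVec_nonneg hD (mulVec_nonneg (hT'.kernelLaplace_nonneg hα hα' hr) ht')
  rw [← hT.lintegral_mlKernel hα hα' hπ hinner hs]
  refine setLIntegral_congr_fun measurableSet_Ioi fun u hu => ?_
  have hrow := vecMul_mlKernel_mul_nonneg hα hα' hT hπ hD hu
  have hsplit : ∀ v : ℝ, ENNReal.ofReal (planeDensity α π T D T' t' u v) *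
      ENNReal.ofReal (Real.exp (-(s * u + r * v))) = ENNReal.ofReal (Real.exp (-(s * u))) *
      ENNReal.ofReal (Real.exp (-(r * v)) *
        ((π ᵥ* (mlKernel α T u * D)) ⬝ᵥ (mlKernel α T' v *ᵥ t'))) := fun v => by
    rw [planeDensity_eq, neg_add, Real.exp_add, mul_comm,
      ← ENNReal.ofReal_mul (by positivity), ← ENNReal.ofReal_mul (by positivity), mul_assoc]
  simp_rw [hsplit]
  rw [lintegral_const_mul' _ _ ENNReal.ofReal_ne_top, hT'.lintegral_mlKernel hα hα' hrow ht' hr,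
    ← ENNReal.ofReal_mul (by positivity), ← dotProduct_mulVec, mulVec_mulVec, mulVec_mulVec,
    mulVec_mulVec]

end Densities

lemma IsPHParam.isSubIntensity {S : Type*} [Fintype S] [DecidableEq S] {π : S → ℝ}
    {T : Matrix S S ℝ} (h : IsPHParam π T) : IsSubIntensity T :=
  ⟨h.offDiag_nonneg, h.exit_nonneg⟩

lemma IsSubIntensity.inv_mulVec_eq {S : Type*} [Fintype S] [DecidableEq S] {T : Matrix S S ℝ}
    (hT : IsSubIntensity T) {d : S → ℝ} (hd : ∀ i, 0 < d i) {x t : S → ℝ}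
    (hx : (diagonal d - T) *ᵥ x = t) : (diagonal d - T)⁻¹ *ᵥ t = x := by
  rw [← hx, mulVec_mulVec, nonsing_inv_mul _ (isUnit_iff_ne_zero.2 (hT.det_ne_zero hd)), one_mulVec]

section Block

variable {p₁ p₂ p₃ : ℕ} {T₁₁ : Matrix (Fin p₁) (Fin p₁) ℝ} {T₁₂ : Matrix (Fin p₁) (Fin p₂) ℝ}
  {T₁₃ : Matrix (Fin p₁) (Fin p₃) ℝ} {T₂₂ : Matrix (Fin p₂) (Fin p₂) ℝ}
  {T₃₃ : Matrix (Fin p₃) (Fin p₃) ℝ}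

lemma exitVector_blockT_inl (i : Fin p₁) :
    exitVector (blockT T₁₁ T₁₂ T₁₃ T₂₂ T₃₃) (Sum.inl i) =
      exitVector T₁₁ i - (∑ j, T₁₂ i j + ∑ j, T₁₃ i j) := by
  simp only [exitVector_apply, blockT, Fintype.sum_sum_type, fromBlocks_apply₁₁, fromBlocks_apply₁₂,
    fromCols_apply_inl, fromCols_apply_inr]
  ring

lemma exitVector_blockT_inr_inl (i : Fin p₂) :
    exitVector (blockT T₁₁ T₁₂ T₁₃ T₂₂ T₃₃) (Sum.inr (Sum.inl i)) = exitVector T₂₂ i := by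
  simp [exitVector_apply, blockT, Fintype.sum_sum_type]

lemma exitVector_blockT_inr_inr (i : Fin p₃) :
    exitVector (blockT T₁₁ T₁₂ T₁₃ T₂₂ T₃₃) (Sum.inr (Sum.inr i)) = exitVector T₃₃ i := by
  simp [exitVector_apply, blockT, Fintype.sum_sum_type]

section SubIntensity

variable (hT : IsSubIntensity (blockT T₁₁ T₁₂ T₁₃ T₂₂ T₃₃))
include hT

lemma IsSubIntensity.block₁₂_nonneg (i : Fin p₁) (j : Fin p₂) : 0 ≤ T₁₂ i j := by
  simpa [blockT] using hT.offDiag_nonneg (Sum.inl i) (Sum.inr (Sum.inl j)) (by simp)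

lemma IsSubIntensity.block₁₃_nonneg (i : Fin p₁) (j : Fin p₃) : 0 ≤ T₁₃ i j := by
  simpa [blockT] using hT.offDiag_nonneg (Sum.inl i) (Sum.inr (Sum.inr j)) (by simp)

lemma IsSubIntensity.block₁₁ : IsSubIntensity T₁₁ where
  offDiag_nonneg i j hij := by
    simpa [blockT] using hT.offDiag_nonneg (Sum.inl i) (Sum.inl j) (by simpa using hij)
  exit_nonneg i := by
    have hexit := hT.exit_nonneg (Sum.inl i)
    have h₁₂ : 0 ≤ ∑ j, T₁₂ i j := Finset.sum_nonneg fun j _ => hT.block₁₂_nonneg i j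
    have h₁₃ : 0 ≤ ∑ j, T₁₃ i j := Finset.sum_nonneg fun j _ => hT.block₁₃_nonneg i j
    rw [exitVector_blockT_inl] at hexit
    linarith

lemma IsSubIntensity.block₂₂ : IsSubIntensity T₂₂ where
  offDiag_nonneg i j hij := by
    simpa [blockT] using hT.offDiag_nonneg (Sum.inr (Sum.inl i)) (Sum.inr (Sum.inl j))
      (by simpa using hij)
  exit_nonneg i := exitVector_blockT_inr_inl (T₁₁ := T₁₁) i ▸ hT.exit_nonneg _

lemma IsSubIntensity.block₃₃ : IsSubIntensity T₃₃ where
  offDiag_nonneg i j hij := by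
    simpa [blockT] using hT.offDiag_nonneg (Sum.inr (Sum.inr i)) (Sum.inr (Sum.inr j))
      (by simpa using hij)
  exit_nonneg i := exitVector_blockT_inr_inr (T₁₁ := T₁₁) i ▸ hT.exit_nonneg _

end SubIntensity

lemma blockR_mulVec (θ : Fin 2 → ℝ) : blockR p₁ p₂ p₃ *ᵥ θ =
    Sum.elim (fun _ => θ 0 + θ 1) (Sum.elim (fun _ => θ 0) fun _ => θ 1) := by
  ext i
  rcases i with i | i | i <;> simp [blockR, mulVec, dotProduct, Fin.sum_univ_two]

lemma diagonal_sub_blockT_mulVec (d₁ d₂ d₃ : ℝ) (x₁ : Fin p₁ → ℝ) (x₂ : Fin p₂ → ℝ)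
    (x₃ : Fin p₃ → ℝ) :
    (diagonal (Sum.elim (fun _ => d₁) (Sum.elim (fun _ => d₂) fun _ => d₃)) -
        blockT T₁₁ T₁₂ T₁₃ T₂₂ T₃₃) *ᵥ Sum.elim x₁ (Sum.elim x₂ x₃) =
      Sum.elim ((diagonal (fun _ => d₁) - T₁₁) *ᵥ x₁ - (T₁₂ *ᵥ x₂ + T₁₃ *ᵥ x₃))
        (Sum.elim ((diagonal (fun _ => d₂) - T₂₂) *ᵥ x₂)
          ((diagonal (fun _ => d₃) - T₃₃) *ᵥ x₃)) := by
  ext i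
  rcases i with i | i | i <;>
    simp [blockT, sub_mulVec, fromBlocks_mulVec, mulVec_diagonal, sub_sub]

section Resolvent

variable {α : ℝ} (hα : 0 < α) (hα' : α ≤ 1) (hT : IsSubIntensity (blockT T₁₁ T₁₂ T₁₃ T₂₂ T₃₃))
  {θ : Fin 2 → ℝ} (hθ : ∀ k, 0 < θ k)
include hα hα' hT hθ

lemma inv_diagonal_sub_blockT_mulVec (t₁ : Fin p₁ → ℝ) (t₂ : Fin p₂ → ℝ) (t₃ : Fin p₃ → ℝ) :
    (diagonal (fun i => (blockR p₁ p₂ p₃ *ᵥ θ) i ^ α) -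
      blockT T₁₁ T₁₂ T₁₃ T₂₂ T₃₃)⁻¹ *ᵥ Sum.elim t₁ (Sum.elim t₂ t₃) =
    Sum.elim (kernelLaplace α T₁₁ (θ 0 + θ 1) *ᵥ (T₁₂ *ᵥ (kernelLaplace α T₂₂ (θ 0) *ᵥ t₂) +
        T₁₃ *ᵥ (kernelLaplace α T₃₃ (θ 1) *ᵥ t₃) + t₁))
      (Sum.elim (kernelLaplace α T₂₂ (θ 0) *ᵥ t₂) (kernelLaplace α T₃₃ (θ 1) *ᵥ t₃)) := by
  have hθ₀₁ : 0 < θ 0 + θ 1 := add_pos (hθ 0) (hθ 1)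
  have hrates : (fun i => (blockR p₁ p₂ p₃ *ᵥ θ) i ^ α) = Sum.elim (fun _ => (θ 0 + θ 1) ^ α)
      (Sum.elim (fun _ => θ 0 ^ α) fun _ => θ 1 ^ α) := by
    ext i
    rw [blockR_mulVec]
    rcases i with _ | _ | _ <;> rfl
  rw [hrates]
  refine hT.inv_mulVec_eq ?_ ?_
  · rintro (_ | _ | _)
    · exact Real.rpow_pos_of_pos hθ₀₁ α
    · exact Real.rpow_pos_of_pos (hθ 0) α
    · exact Real.rpow_pos_of_pos (hθ 1) α
  · rw [diagonal_sub_blockT_mulVec,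
      mulVec_mulVec_of_mul_eq_one (hT.block₁₁.diagonal_sub_mul_kernelLaplace hα hα' hθ₀₁),
      mulVec_mulVec_of_mul_eq_one (hT.block₂₂.diagonal_sub_mul_kernelLaplace hα hα' (hθ 0)),
      mulVec_mulVec_of_mul_eq_one (hT.block₃₃.diagonal_sub_mul_kernelLaplace hα hα' (hθ 1)),
      add_sub_cancel_left]

lemma blockInit_dotProduct_inv_mulVec (π₁ t₁ : Fin p₁ → ℝ) (π₂ t₂ : Fin p₂ → ℝ)
    (π₃ t₃ : Fin p₃ → ℝ) :
    blockInit π₁ π₂ π₃ ⬝ᵥ ((diagonal (fun i => (blockR p₁ p₂ p₃ *ᵥ θ) i ^ α) -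
      blockT T₁₁ T₁₂ T₁₃ T₂₂ T₃₃)⁻¹ *ᵥ Sum.elim t₁ (Sum.elim t₂ t₃)) =
    π₁ ⬝ᵥ (kernelLaplace α T₁₁ (θ 0 + θ 1) *ᵥ (T₁₂ *ᵥ (kernelLaplace α T₂₂ (θ 0) *ᵥ t₂))) +
    π₁ ⬝ᵥ (kernelLaplace α T₁₁ (θ 0 + θ 1) *ᵥ (T₁₃ *ᵥ (kernelLaplace α T₃₃ (θ 1) *ᵥ t₃))) +
    π₁ ⬝ᵥ (kernelLaplace α T₁₁ (θ 0 + θ 1) *ᵥ t₁) +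
    π₂ ⬝ᵥ (kernelLaplace α T₂₂ (θ 0) *ᵥ t₂) + π₃ ⬝ᵥ (kernelLaplace α T₃₃ (θ 1) *ᵥ t₃) := by
  rw [inv_diagonal_sub_blockT_mulVec hα hα' hT hθ, blockInit, sumElim_dotProduct_sumElim,
    sumElim_dotProduct_sumElim, mulVec_add, mulVec_add, dotProduct_add, dotProduct_add, ← add_assoc]

end Resolvent

lemma measurable_exp_neg_dotProduct {ι : Type*} [Fintype ι] (θ : ι → ℝ) :
    Measurable fun y : ι → ℝ => Real.exp (-(y ⬝ᵥ θ)) := by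
  unfold dotProduct
  fun_prop

lemma lintegral_exp_neg_piecewiseMeasure {f₁ f₂ : ℝ → ℝ → ℝ} {g h₁ h₂ : ℝ → ℝ} (c : ℝ)
    (hf₁ : Measurable fun z : Fin 2 → ℝ => f₁ (z 0) (z 1))
    (hf₂ : Measurable fun z : Fin 2 → ℝ => f₂ (z 0) (z 1))
    (hg : Measurable g) (hh₁ : Measurable h₁) (hh₂ : Measurable h₂) (θ : Fin 2 → ℝ) :
    ∫⁻ y, ENNReal.ofReal (Real.exp (-(y ⬝ᵥ θ))) ∂piecewiseMeasure f₁ f₂ g h₁ h₂ c =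
      (∫⁻ u in Set.Ioi (0 : ℝ), ∫⁻ v in Set.Ioi (0 : ℝ), ENNReal.ofReal (f₁ (u + v) u) *
        ENNReal.ofReal (Real.exp (-((θ 0 + θ 1) * u + θ 0 * v)))) +
      (∫⁻ u in Set.Ioi (0 : ℝ), ∫⁻ v in Set.Ioi (0 : ℝ), ENNReal.ofReal (f₂ u (u + v)) *
        ENNReal.ofReal (Real.exp (-((θ 0 + θ 1) * u + θ 1 * v)))) +
      (∫⁻ x in Set.Ioi (0 : ℝ), ENNReal.ofReal (g x) *
        ENNReal.ofReal (Real.exp (-((θ 0 + θ 1) * x)))) +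
      (∫⁻ x in Set.Ioi (0 : ℝ), ENNReal.ofReal (h₁ x) *
        ENNReal.ofReal (Real.exp (-(θ 0 * x)))) +
      (∫⁻ x in Set.Ioi (0 : ℝ), ENNReal.ofReal (h₂ x) *
        ENNReal.ofReal (Real.exp (-(θ 1 * x)))) + ENNReal.ofReal c := by
  have hdot : ∀ x y : ℝ, ![x, y] ⬝ᵥ θ = θ 0 * x + θ 1 * y := fun x y => by
    simp [dotProduct, Fin.sum_univ_two, mul_comm]
  have hlower : ∀ u v : ℝ, θ 0 * (u + v) + θ 1 * u = (θ 0 + θ 1) * u + θ 0 * v := fun u v => by ring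
  have hupper : ∀ u v : ℝ, θ 0 * u + θ 1 * (u + v) = (θ 0 + θ 1) * u + θ 1 * v := fun u v => by ring
  rw [lintegral_piecewiseMeasure c hf₁ hf₂ hg hh₁ hh₂
    (measurable_exp_neg_dotProduct θ).ennreal_ofReal]
  simp only [hdot, hlower, hupper, ← add_mul, mul_zero, add_zero, zero_add, zero_dotProduct,
    neg_zero, Real.exp_zero, ENNReal.ofReal_one, mul_one]

section ExplicitForm

variable {α : ℝ} (hα : 0 < α) (hα' : α ≤ 1)
include hα hα'

lemma lintegral_exp_neg_explicitForm (hT : IsSubIntensity (blockT T₁₁ T₁₂ T₁₃ T₂₂ T₃₃))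
    {π₁ t₁ : Fin p₁ → ℝ} {π₂ t₂ : Fin p₂ → ℝ} {π₃ t₃ : Fin p₃ → ℝ}
    (hπ : ∀ i, 0 ≤ blockInit π₁ π₂ π₃ i) (ht₁ : ∀ i, 0 ≤ t₁ i) (ht₂ : ∀ i, 0 ≤ t₂ i)
    (ht₃ : ∀ i, 0 ≤ t₃ i) {c : ℝ} (hc : 0 ≤ c) {θ : Fin 2 → ℝ} (hθ : ∀ k, 0 < θ k) :
    ∫⁻ y, ENNReal.ofReal (Real.exp (-(y ⬝ᵥ θ))) ∂piecewiseMeasure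
        (fun x y => planeDensity α π₁ T₁₁ T₁₂ T₂₂ t₂ y (x - y))
        (fun x y => planeDensity α π₁ T₁₁ T₁₃ T₃₃ t₃ x (y - x))
        (lineDensity α π₁ T₁₁ t₁) (lineDensity α π₂ T₂₂ t₂) (lineDensity α π₃ T₃₃ t₃) c =
      ENNReal.ofReal (c + blockInit π₁ π₂ π₃ ⬝ᵥ
          ((diagonal (fun i => (blockR p₁ p₂ p₃ *ᵥ θ) i ^ α) - blockT T₁₁ T₁₂ T₁₃ T₂₂ T₃₃)⁻¹ *ᵥ
            Sum.elim t₁ (Sum.elim t₂ t₃))) := by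
  have hπ₁ : ∀ i, 0 ≤ π₁ i := fun i => hπ (Sum.inl i)
  have hπ₂ : ∀ i, 0 ≤ π₂ i := fun i => hπ (Sum.inr (Sum.inl i))
  have hπ₃ : ∀ i, 0 ≤ π₃ i := fun i => hπ (Sum.inr (Sum.inr i))
  have hθ₀₁ : 0 < θ 0 + θ 1 := add_pos (hθ 0) (hθ 1)
  have hL₁ {v : Fin p₁ → ℝ} (hv : ∀ i, 0 ≤ v i) :
      ∀ i, 0 ≤ (kernelLaplace α T₁₁ (θ 0 + θ 1) *ᵥ v) i :=
    mulVec_nonneg (hT.block₁₁.kernelLaplace_nonneg hα hα' hθ₀₁) hv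
  have hL₂ := mulVec_nonneg (hT.block₂₂.kernelLaplace_nonneg hα hα' (hθ 0)) ht₂
  have hL₃ := mulVec_nonneg (hT.block₃₃.kernelLaplace_nonneg hα hα' (hθ 1)) ht₃
  have hlower : 0 ≤ π₁ ⬝ᵥ _ :=
    dotProduct_nonneg_of_nonneg hπ₁ (hL₁ (mulVec_nonneg hT.block₁₂_nonneg hL₂))
  have hupper : 0 ≤ π₁ ⬝ᵥ _ :=
    dotProduct_nonneg_of_nonneg hπ₁ (hL₁ (mulVec_nonneg hT.block₁₃_nonneg hL₃))
  have hdiag : 0 ≤ π₁ ⬝ᵥ _ := dotProduct_nonneg_of_nonneg hπ₁ (hL₁ ht₁)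
  have haxis₁ : 0 ≤ π₂ ⬝ᵥ _ := dotProduct_nonneg_of_nonneg hπ₂ hL₂
  have haxis₂ : 0 ≤ π₃ ⬝ᵥ _ := dotProduct_nonneg_of_nonneg hπ₃ hL₃
  rw [lintegral_exp_neg_piecewiseMeasure c
    (f₁ := fun x y => planeDensity α π₁ T₁₁ T₁₂ T₂₂ t₂ y (x - y))
    (f₂ := fun x y => planeDensity α π₁ T₁₁ T₁₃ T₃₃ t₃ x (y - x))
    (measurable_planeDensity hα (by fun_prop) (by fun_prop))
    (measurable_planeDensity hα (by fun_prop) (by fun_prop)) (measurable_lineDensity hα)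
    (measurable_lineDensity hα) (measurable_lineDensity hα)]
  simp only [add_sub_cancel_left]
  rw [lintegral_planeDensity hα hα' hT.block₁₁ hπ₁ hT.block₂₂ hT.block₁₂_nonneg ht₂ hθ₀₁ (hθ 0),
    lintegral_planeDensity hα hα' hT.block₁₁ hπ₁ hT.block₃₃ hT.block₁₃_nonneg ht₃ hθ₀₁ (hθ 1),
    lintegral_lineDensity hα hα' hT.block₁₁ hπ₁ ht₁ hθ₀₁,
    lintegral_lineDensity hα hα' hT.block₂₂ hπ₂ ht₂ (hθ 0),
    lintegral_lineDensity hα hα' hT.block₃₃ hπ₃ ht₃ (hθ 1),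
    blockInit_dotProduct_inv_mulVec hα hα' hT hθ, add_comm c,
    ENNReal.ofReal_add (by positivity) hc, ENNReal.ofReal_add (by positivity) haxis₂,
    ENNReal.ofReal_add (by positivity) haxis₁, ENNReal.ofReal_add (by positivity) hdiag,
    ENNReal.ofReal_add hlower hupper]

variable {π₁ : Fin p₁ → ℝ} {π₂ : Fin p₂ → ℝ} {π₃ : Fin p₃ → ℝ} {μ : Measure (Fin 2 → ℝ)}
  (hparam : IsPHParam (blockInit π₁ π₂ π₃) (blockT T₁₁ T₁₂ T₁₃ T₂₂ T₃₃))
include hparam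

theorem hasExplicitForm_of_lintegral_exp_neg (hμ : ∀ᵐ y ∂μ, ∀ k, 0 ≤ y k)
    (hlap : ∀ θ : Fin 2 → ℝ, (∀ k, 0 < θ k) →
      ∫⁻ y, ENNReal.ofReal (Real.exp (-(y ⬝ᵥ θ))) ∂μ =
        ENNReal.ofReal ((1 - ∑ i, blockInit π₁ π₂ π₃ i) + blockInit π₁ π₂ π₃ ⬝ᵥ
          ((diagonal (fun i => (blockR p₁ p₂ p₃ *ᵥ θ) i ^ α) - blockT T₁₁ T₁₂ T₁₃ T₂₂ T₃₃)⁻¹ *ᵥ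
            exitVector (blockT T₁₁ T₁₂ T₁₃ T₂₂ T₃₃)))) :
    HasExplicitForm α π₁ π₂ π₃ T₁₁ T₁₂ T₁₃ T₂₂ T₃₃ μ := by
  have hT := hparam.isSubIntensity
  have hπ₁ : ∀ i, 0 ≤ π₁ i := fun i => hparam.init_nonneg (Sum.inl i)
  have hπ₂ : ∀ i, 0 ≤ π₂ i := fun i => hparam.init_nonneg (Sum.inr (Sum.inl i))
  have hπ₃ : ∀ i, 0 ≤ π₃ i := fun i => hparam.init_nonneg (Sum.inr (Sum.inr i))
  have hatom : 0 ≤ 1 - ∑ i, blockInit π₁ π₂ π₃ i := sub_nonneg.2 hparam.init_sum_le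
  have ht := hT.exit_nonneg
  unfold HasExplicitForm
  generalize exitVector (blockT T₁₁ T₁₂ T₁₃ T₂₂ T₃₃) = t at hlap ht ⊢
  have hblocks : t = Sum.elim (fun i => t (Sum.inl i))
      (Sum.elim (fun i => t (Sum.inr (Sum.inl i))) fun i => t (Sum.inr (Sum.inr i))) := by
    ext i
    rcases i with i | i | i <;> rfl
  refine ⟨fun x y hy hxy => ?_, fun x y hx hxy => ?_, fun x hx => ?_, fun x hx => ?_,
    fun y hy => ?_, hatom, ?_⟩
  · exact planeDensity_nonneg hα hα' hT.block₁₁ hπ₁ hT.block₂₂ hT.block₁₂_nonneg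
      (fun _ => ht _) hy (sub_pos.2 hxy)
  · exact planeDensity_nonneg hα hα' hT.block₁₁ hπ₁ hT.block₃₃ hT.block₁₃_nonneg
      (fun _ => ht _) hx (sub_pos.2 hxy)
  · exact lineDensity_nonneg hα hα' hT.block₁₁ hπ₁ (fun _ => ht _) hx
  · exact lineDensity_nonneg hα hα' hT.block₂₂ hπ₂ (fun _ => ht _) hx
  · exact lineDensity_nonneg hα hα' hT.block₃₃ hπ₃ (fun _ => ht _) hy
  · refine measure_ext_of_laplace hμ (piecewiseMeasure_nonneg _ _ _ _ _ _) (fun θ hθ => ?_) ?_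
    · rw [hlap θ hθ, lintegral_exp_neg_explicitForm hα hα' hT hparam.init_nonneg (fun _ => ht _)
        (fun _ => ht _) (fun _ => ht _) hatom hθ, ← hblocks]
    · rw [hlap 1 fun _ => one_pos]
      exact ENNReal.ofReal_ne_top

theorem IsMPH.hasExplicitForm (hμ : IsMPH α (blockInit π₁ π₂ π₃) (blockT T₁₁ T₁₂ T₁₃ T₂₂ T₃₃)
      (blockR p₁ p₂ p₃) μ) :
    HasExplicitForm α π₁ π₂ π₃ T₁₁ T₁₂ T₁₃ T₂₂ T₃₃ μ := by
  have := hμ.isProbabilityMeasure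
  refine hasExplicitForm_of_lintegral_exp_neg hα hα' hparam hμ.nonneg fun θ hθ => ?_
  have hint : Integrable (fun y => Real.exp (-(y ⬝ᵥ θ))) μ := by
    refine .of_bound (measurable_exp_neg_dotProduct θ).aestronglyMeasurable 1 ?_
    filter_upwards [hμ.nonneg] with y hy
    rw [Real.norm_of_nonneg (Real.exp_nonneg _), Real.exp_le_one_iff, neg_nonpos]
    exact dotProduct_nonneg_of_nonneg hy fun k => (hθ k).le
  rw [← hμ.laplace θ fun k => (hθ k).le,
    ofReal_integral_eq_lintegral_ofReal hint (.of_forall fun y => Real.exp_nonneg _)]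

end ExplicitForm

end Block

section Path

variable {S Ω : Type*} {Z : ℕ → Ω → Option S} {H : ℕ → S → Ω → ℝ} {ω : Ω}

lemma jumpTime_zero : jumpTime Z H 0 ω = 0 := by simp [jumpTime]

lemma jumpTime_succ (n : ℕ) : jumpTime Z H (n + 1) ω =
    jumpTime Z H n ω + (Z n ω).elim 0 fun i => H n i ω := by
  simp [jumpTime, Finset.sum_range_succ]

lemma exists_mem_Ico_jumpTime {t : ℝ} (ht : 0 ≤ t) {M : ℕ} (hM : t < jumpTime Z H M ω) :
    ∃ n, t ∈ Set.Ico (jumpTime Z H n ω) (jumpTime Z H (n + 1) ω) := by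
  induction M with
  | zero => exact absurd hM (jumpTime_zero.trans_le ht).not_gt
  | succ n ih =>
    rcases lt_or_ge t (jumpTime Z H n ω) with hlt | hge
    · exact ih hlt
    · exact ⟨n, hge, hM⟩

/-- The vector of rewards accumulated before the `n`-th jump, at the rates given by the rows of
`R`. -/
noncomputable def partialReward {d : ℕ} (R : Matrix S (Fin d) ℝ) (Z : ℕ → Ω → Option S)
    (H : ℕ → S → Ω → ℝ) (n : ℕ) (ω : Ω) : Fin d → ℝ := fun k =>
  ∑ m ∈ Finset.range n, (Z m ω).elim 0 fun i => R i k * H m i ω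

variable (hH : ∀ n i, 0 ≤ H n i ω)
include hH

lemma monotone_jumpTime : Monotone fun n => jumpTime Z H n ω :=
  monotone_nat_of_le_succ fun n => by
    rw [jumpTime_succ]
    cases Z n ω <;> simp [hH]

lemma semiMarkov_of_mem_Ico {n : ℕ} {t : ℝ}
    (ht : t ∈ Set.Ico (jumpTime Z H n ω) (jumpTime Z H (n + 1) ω)) :
    semiMarkov Z H t ω = Z n ω := by
  classical
  have hex : ∃ n, jumpTime Z H n ω ≤ t ∧ t < jumpTime Z H (n + 1) ω := ⟨n, ht⟩
  have hfind : n = Nat.find hex := by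
    refine le_antisymm (not_lt.1 fun hlt => ?_) (Nat.find_min' hex ht)
    exact ((Nat.find_spec hex).2.trans_le (monotone_jumpTime hH hlt)).not_ge ht.1
  rw [semiMarkov, dif_pos hex]
  convert rfl using 2

lemma integral_sojourn (f : Option S → ℝ) (hf : f none = 0) (n : ℕ) :
    ∫ t in jumpTime Z H n ω..jumpTime Z H (n + 1) ω, f (semiMarkov Z H t ω) =
      (Z n ω).elim 0 fun i => f (some i) * H n i ω := by
  have hle : jumpTime Z H n ω ≤ jumpTime Z H (n + 1) ω := monotone_jumpTime hH n.le_succ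
  rw [intervalIntegral.integral_of_le hle, ← integral_Ico_eq_integral_Ioc,
    setIntegral_congr_fun measurableSet_Ico fun t ht => congrArg f (semiMarkov_of_mem_Ico hH ht),
    setIntegral_const, Real.volume_real_Ico_of_le hle, jumpTime_succ]
  cases Z n ω <;> simp [hf, mul_comm]

lemma intervalIntegrable_sojourn (f : Option S → ℝ) (n : ℕ) :
    IntervalIntegrable (fun t => f (semiMarkov Z H t ω)) volume (jumpTime Z H n ω)
      (jumpTime Z H (n + 1) ω) := by
  rw [intervalIntegrable_iff_integrableOn_Ico_of_le (monotone_jumpTime hH n.le_succ)]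
  exact (integrableOn_congr_fun (fun t ht => congrArg f (semiMarkov_of_mem_Ico hH ht))
    measurableSet_Ico).2 (integrableOn_const (by simp))

variable {M : ℕ} (hM : ∀ n ≥ M, Z n ω = none)
include hM

omit hH in
lemma jumpTime_eq_of_le {n : ℕ} (hn : M ≤ n) : jumpTime Z H n ω = jumpTime Z H M ω := by
  induction n, hn using Nat.le_induction with
  | base => rfl
  | succ n hn ih => rw [jumpTime_succ, ih, hM n hn, Option.elim_none, add_zero]

lemma jumpTime_le (n : ℕ) : jumpTime Z H n ω ≤ jumpTime Z H M ω :=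
  (le_total n M).elim (fun h => monotone_jumpTime hH h) fun h => (jumpTime_eq_of_le hM h).le

lemma semiMarkov_eq_none_iff {t : ℝ} (ht : 0 ≤ t) :
    semiMarkov Z H t ω = none ↔ jumpTime Z H M ω ≤ t := by
  constructor
  · intro hnone
    by_contra! hlt
    obtain ⟨n, hn⟩ := exists_mem_Ico_jumpTime ht hlt
    have hlt_succ := hn.2
    rw [jumpTime_succ, ← semiMarkov_of_mem_Ico hH hn, hnone, Option.elim_none, add_zero] at hlt_succ
    exact hlt_succ.not_ge hn.1
  · intro hle
    rw [semiMarkov, dif_neg]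
    rintro ⟨n, -, hn⟩
    exact hn.not_ge ((jumpTime_le hH hM _).trans hle)

lemma absorptionTime_eq : absorptionTime Z H ω = jumpTime Z H M ω := by
  have hnonneg : 0 ≤ jumpTime Z H M ω :=
    jumpTime_zero (Z := Z) (H := H) ▸ monotone_jumpTime hH M.zero_le
  have habsorbed : {t : ℝ | 0 ≤ t ∧ semiMarkov Z H t ω = none} = Set.Ici (jumpTime Z H M ω) := by
    ext t
    exact ⟨fun h => (semiMarkov_eq_none_iff hH hM h.1).1 h.2,
      fun h => ⟨hnonneg.trans h, (semiMarkov_eq_none_iff hH hM (hnonneg.trans h)).2 h⟩⟩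
  rw [absorptionTime, habsorbed, csInf_Ici]

lemma totalReward_eq_partialReward [Fintype S] {d : ℕ} (R : Matrix S (Fin d) ℝ) :
    totalReward R Z H ω = partialReward R Z H M ω := by
  classical
  ext k
  let rate : Option S → ℝ := fun o => o.elim 0 fun i => R i k
  have hrate : ∀ o, ∑ i, R i k * (if o = some i then 1 else 0) = rate o := fun o => by
    cases o <;> simp [rate]
  calc totalReward R Z H ω k
      = ∫ t in jumpTime Z H 0 ω..jumpTime Z H M ω, rate (semiMarkov Z H t ω) := by
        simp only [totalReward, hrate, absorptionTime_eq hH hM, jumpTime_zero]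
    _ = ∑ n ∈ Finset.range M,
          ∫ t in jumpTime Z H n ω..jumpTime Z H (n + 1) ω, rate (semiMarkov Z H t ω) :=
        (intervalIntegral.sum_integral_adjacent_intervals fun n _ =>
          intervalIntegrable_sojourn hH rate n).symm
    _ = partialReward R Z H M ω k := Finset.sum_congr rfl fun n _ => integral_sojourn hH rate rfl n

end Path

section Embedded

variable {S : Type*} [Fintype S] [DecidableEq S] {π : S → ℝ} {T : Matrix S S ℝ}

lemma IsPHParam.diag_neg (h : IsPHParam π T) (i : S) : T i i < 0 := by
  have hexit := h.exit_nonneg i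
  rw [exitVector_apply, ← Finset.add_sum_erase _ _ (Finset.mem_univ i)] at hexit
  have hoff : ∀ j ∈ Finset.univ.erase i, 0 ≤ T i j := fun j hj =>
    h.offDiag_nonneg i j (Finset.ne_of_mem_erase hj).symm
  have hsum := Finset.sum_nonneg hoff
  by_contra! hdiag
  have hzero := (Finset.sum_eq_zero_iff_of_nonneg hoff).1 (by linarith)
  refine h.det_ne_zero (det_eq_zero_of_row_eq_zero i fun j => ?_)
  rcases eq_or_ne j i with rfl | hj
  · linarith
  · exact hzero j (Finset.mem_erase.2 ⟨hj, Finset.mem_univ j⟩)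

lemma sum_embedded_some {i : S} (hi : T i i ≠ 0) (f : Option S → ℝ) :
    ∑ o, embedded T (some i) o * f o =
      (exitVector T i * f none + ∑ j, T i j * f (some j)) / (-T i i) + f (some i) := by
  have hjump : ∀ j, embedded T (some i) (some j) * f (some j) =
      T i j * f (some j) / (-T i i) + if i = j then f (some j) else 0 := fun j => by
    simp only [embedded]
    split_ifs with hij
    · subst hij
      field_simp
      ring
    · ring
  simp_rw [Fintype.sum_option, hjump]
  rw [Finset.sum_add_distrib, Finset.sum_ite_eq, if_pos (Finset.mem_univ i), ← Finset.sum_div,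
    embedded]
  ring

lemma sum_embedded_none (f : Option S → ℝ) : ∑ o, embedded T none o * f o = f none := by
  simp [Fintype.sum_option, embedded]

end Embedded

section Sojourn

lemma mlDistribution_pos (α l : ℝ) : ∀ᵐ x ∂mlDistribution α l, 0 < x :=
  (withDensity_absolutelyContinuous _ _).ae_le (ae_restrict_mem measurableSet_Ioi)

lemma isSubIntensity_diagonal_neg {S : Type*} [Fintype S] [DecidableEq S] {l : S → ℝ}
    (hl : ∀ i, 0 ≤ l i) : IsSubIntensity (diagonal fun i => -l i) where
  offDiag_nonneg i j hij := (diagonal_apply_ne _ hij).ge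
  exit_nonneg i := by simp [exitVector, mulVec_diagonal, hl]

lemma mittagLeffler_diagonal {S : Type*} [Fintype S] [DecidableEq S] {α β : ℝ} (hα : 0 < α)
    (hβ : 0 < β) (d : S → ℝ) :
    mittagLeffler α β (diagonal d) = diagonal fun i => mittagLeffler α β (d i) := by
  have hsum : Summable fun k : ℕ => (Real.Gamma (α * k + β))⁻¹ • d ^ k :=
    Pi.summable.2 fun i => summable_mittagLeffler hα hβ (d i)
  simp only [mittagLeffler, diagonal_pow, ← diagonal_smul, ← diagonal_tsum]
  exact congrArg diagonal (funext fun i => tsum_apply hsum)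

lemma mlKernel_diagonal_apply_self {S : Type*} [Fintype S] [DecidableEq S] {α : ℝ} (hα : 0 < α)
    (d : S → ℝ) (x : ℝ) (i : S) :
    mlKernel α (diagonal d) x i i = x ^ (α - 1) * mittagLeffler α α (d i * x ^ α) := by
  rw [mlKernel, ← diagonal_smul, mittagLeffler_diagonal hα hα, Matrix.smul_apply, diagonal_apply_eq,
    Pi.smul_apply, smul_eq_mul, smul_eq_mul, mul_comm (d i)]

lemma kernelLaplace_diagonal_apply_self {S : Type*} [Fintype S] [DecidableEq S] {α s : ℝ}
    (hα : 0 < α) (hα' : α ≤ 1) {l : S → ℝ} (hl : ∀ i, 0 ≤ l i) (hs : 0 < s) (i : S) :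
    kernelLaplace α (diagonal fun i => -l i) s i i = (s ^ α + l i)⁻¹ := by
  have hres := congrFun (congrFun
    ((isSubIntensity_diagonal_neg hl).diagonal_sub_mul_kernelLaplace hα hα' hs) i) i
  rw [diagonal_sub, diagonal_mul, one_apply_eq, sub_neg_eq_add] at hres
  exact eq_inv_of_mul_eq_one_right hres

lemma lintegral_exp_mlDistribution {α l s : ℝ} (hα : 0 < α) (hα' : α ≤ 1) (hl : 0 ≤ l)
    (hs : 0 < s) : ∫⁻ x, ENNReal.ofReal (Real.exp (-(s * x))) ∂mlDistribution α l =
      ENNReal.ofReal (l / (s ^ α + l)) := by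
  let T : Matrix Unit Unit ℝ := diagonal fun _ => -l
  have hT : IsSubIntensity T := isSubIntensity_diagonal_neg fun _ => hl
  have hdens : ∀ x, l * x ^ (α - 1) * mittagLeffler α α (-l * x ^ α) =
      (fun _ => l) ⬝ᵥ (mlKernel α T x *ᵥ fun _ => 1) := fun x => by
    simp [T, dotProduct, mulVec, mlKernel_diagonal_apply_self hα, mul_assoc]
  have hkernel : l / (s ^ α + l) = (fun _ => l) ⬝ᵥ (kernelLaplace α T s *ᵥ fun _ => 1) := by
    simp [T, dotProduct, mulVec, kernelLaplace_diagonal_apply_self hα hα' (fun _ => hl) hs,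
      div_eq_mul_inv]
  simp only [mlDistribution, hdens]
  rw [lintegral_withDensity_eq_lintegral_mul _ (measurable_dotProduct_mlKernel hα).ennreal_ofReal
    (by fun_prop), hkernel,
    ← hT.lintegral_mlKernel hα hα' (fun _ => hl) (fun _ => zero_le_one) hs]
  refine lintegral_congr fun x => ?_
  rw [Pi.mul_apply, mul_comm, ← ENNReal.ofReal_mul (Real.exp_nonneg _)]

lemma integral_exp_mlDistribution {α l s : ℝ} (hα : 0 < α) (hα' : α ≤ 1) (hl : 0 ≤ l)
    (hs : 0 < s) : ∫ x, Real.exp (-(s * x)) ∂mlDistribution α l = l / (s ^ α + l) := by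
  rw [integral_eq_lintegral_of_nonneg_ae (.of_forall fun _ => Real.exp_nonneg _)
    (by fun_prop : Measurable fun x : ℝ => Real.exp (-(s * x))).aestronglyMeasurable,
    lintegral_exp_mlDistribution hα hα' hl hs, ENNReal.toReal_ofReal (by positivity)]

end Sojourn

lemma integral_eq_sum_setIntegral {Ω ι : Type*} [MeasurableSpace Ω] {P : Measure Ω} [Fintype ι]
    {W : Ω → ι} (hW : ∀ i, MeasurableSet {ω | W ω = i}) {X : Ω → ℝ} (hX : Integrable X P) :
    ∫ ω, X ω ∂P = ∑ i, ∫ ω in {ω | W ω = i}, X ω ∂P := by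
  rw [← integral_iUnion_fintype hW ?_ fun i => hX.integrableOn]
  · rw [Set.iUnion_eq_univ_iff.2 fun ω => ⟨W ω, rfl⟩, setIntegral_univ]
  · exact fun i j hij => Set.disjoint_left.2 fun ω hi hj => hij (hi.symm.trans hj)

section PathWeight

variable {S : Type*}

/-- The exponential `exp (-∑ₘ r_{zₘ} hₘ,zₘ)` of the reward collected at the rates `r` during the
first `k` sojourns of the path `z`, where `h m i` is the length of the `m`-th sojourn if it is spent
in the state `i`; the absorbing state earns nothing. -/
noncomputable def pathWeight (r : S → ℝ) (k : ℕ) (z : ℕ → Option S) (h : ℕ → S → ℝ) : ℝ :=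
  ∏ m ∈ Finset.range k, (z m).elim 1 fun i => Real.exp (-(r i * h m i))

lemma pathWeight_congr {r : S → ℝ} {k : ℕ} {z z' : ℕ → Option S} (hz : ∀ m < k, z m = z' m)
    (h : ℕ → S → ℝ) : pathWeight r k z h = pathWeight r k z' h :=
  Finset.prod_congr rfl fun m hm => by rw [hz m (Finset.mem_range.1 hm)]

lemma pathWeight_zero_left (k : ℕ) (z : ℕ → Option S) (h : ℕ → S → ℝ) :
    pathWeight 0 k z h = 1 :=
  Finset.prod_eq_one fun m _ => by cases z m <;> simp

lemma measurable_pathWeight (r : S → ℝ) (k : ℕ) (z : ℕ → Option S) :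
    Measurable (pathWeight r k z) :=
  Finset.measurable_fun_prod _ fun m _ => by
    cases z m with
    | none => exact measurable_const
    | some i =>
      simp only [Option.elim_some]
      fun_prop

lemma pathWeight_nonneg (r : S → ℝ) (k : ℕ) (z : ℕ → Option S) (h : ℕ → S → ℝ) :
    0 ≤ pathWeight r k z h :=
  Finset.prod_nonneg fun m _ => by cases z m <;> simp [Real.exp_nonneg]

lemma pathWeight_le_one {r : S → ℝ} (hr : ∀ i, 0 ≤ r i) (k : ℕ) (z : ℕ → Option S)
    {h : ℕ → S → ℝ} (hh : ∀ m i, 0 ≤ h m i) : pathWeight r k z h ≤ 1 := by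
  refine Finset.prod_le_one (fun m _ => ?_) fun m _ => ?_
  · cases z m <;> simp [Real.exp_nonneg]
  · cases z m with
    | none => exact le_rfl
    | some i => simpa using mul_nonneg (hr i) (hh m i)

lemma exp_neg_partialReward_dotProduct {Ω : Type*} {d : ℕ} (R : Matrix S (Fin d) ℝ)
    (Z : ℕ → Ω → Option S) (H : ℕ → S → Ω → ℝ) (n : ℕ) (ω : Ω) (θ : Fin d → ℝ) :
    Real.exp (-(partialReward R Z H n ω ⬝ᵥ θ)) =
      pathWeight (R *ᵥ θ) n (fun m => Z m ω) fun m i => H m i ω := by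
  have hexponent : -(partialReward R Z H n ω ⬝ᵥ θ) =
      ∑ m ∈ Finset.range n, (Z m ω).elim 0 fun i => -((R *ᵥ θ) i * H m i ω) := by
    simp only [partialReward, dotProduct, Finset.sum_mul]
    rw [Finset.sum_comm, ← Finset.sum_neg_distrib]
    refine Finset.sum_congr rfl fun m _ => ?_
    cases Z m ω with
    | none => simp
    | some i => simp only [Option.elim_some, mulVec, dotProduct, Finset.sum_mul, mul_right_comm]
  rw [hexponent, Real.exp_sum, pathWeight]
  refine Finset.prod_congr rfl fun m _ => ?_
  cases Z m ω <;> simp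

variable [Fintype S]

lemma norm_pathWeight_mul_le {r : S → ℝ} (hr : ∀ i, 0 ≤ r i) (k : ℕ) (z : ℕ → Option S)
    {h : ℕ → S → ℝ} (hh : ∀ m i, 0 ≤ h m i) (f : Option S → ℝ) (o : Option S) :
    ‖pathWeight r k z h * f o‖ ≤ ‖f‖ := by
  rw [norm_mul, Real.norm_of_nonneg (pathWeight_nonneg r k z h)]
  exact (mul_le_of_le_one_left (norm_nonneg _) (pathWeight_le_one hr k z hh)).trans
    (norm_le_pi_norm f o)

end PathWeight

section Potential

variable {S : Type*} [Fintype S] [DecidableEq S] {π : S → ℝ} {T : Matrix S S ℝ}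

/-- The entries of `T⁻¹ *ᵥ Pi.single i (T i i)` are the expected numbers of visits to `i`. -/
lemma IsPHParam.sum_embedded_mul_inv_mulVec_single (hparam : IsPHParam π T) (i : S)
    (o : Option S) :
    ∑ o', embedded T o o' * o'.elim 0 (T⁻¹ *ᵥ Pi.single i (T i i)) =
      o.elim 0 (T⁻¹ *ᵥ Pi.single i (T i i)) - if o = some i then 1 else 0 := by
  cases o with
  | none =>
    rw [sum_embedded_none]
    simp
  | some j =>
    have hsolve : ∑ l, T j l * (T⁻¹ *ᵥ Pi.single i (T i i)) l =
        (Pi.single i (T i i) : S → ℝ) j := congrFun (mulVec_mulVec_of_mul_eq_one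
      (mul_nonsing_inv _ (isUnit_iff_ne_zero.2 hparam.det_ne_zero)) (Pi.single i (T i i))) j
    rw [sum_embedded_some (hparam.diag_neg j).ne]
    simp only [Option.elim_none, Option.elim_some, mul_zero, zero_add, hsolve, Option.some.injEq]
    rcases eq_or_ne j i with rfl | hij
    · rw [Pi.single_eq_same, if_pos rfl, div_neg, div_self (hparam.diag_neg j).ne]
      ring
    · simp [hij]

lemma IsPHParam.discounted_sum_embedded (hparam : IsPHParam π T) {d x : S → ℝ}
    (hd : ∀ i, 0 ≤ d i) (hx : (diagonal d - T) *ᵥ x = exitVector T) (o : Option S) :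
    (o.elim 1 fun i => -T i i / (d i + -T i i)) * ∑ o', embedded T o o' * o'.elim 1 x =
      o.elim 1 x := by
  cases o with
  | none =>
    rw [sum_embedded_none]
    simp
  | some i =>
    have hdiag := hparam.diag_neg i
    have hrate : d i + -T i i ≠ 0 := (add_pos_of_nonneg_of_pos (hd i) (neg_pos.2 hdiag)).ne'
    have hrow : d i * x i - ∑ j, T i j * x j = exitVector T i := by
      rw [← diagonal_sub_mulVec, hx]
    rw [sum_embedded_some hdiag.ne]
    simp only [Option.elim_none, Option.elim_some, ← hrow]
    have := hdiag.ne
    field_simp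
    ring

end Potential

section Model

/-- The event that the chain `Z` follows the path `z` up to time `n`. -/
def pathEvent {S Ω : Type*} (Z : ℕ → Ω → Option S) (n : ℕ) (z : ℕ → Option S) : Set Ω :=
  {ω | ∀ m ≤ n, Z m ω = z m}

lemma pathEvent_inter {S Ω : Type*} (Z : ℕ → Ω → Option S) (n : ℕ) (z : ℕ → Option S)
    (o : Option S) : pathEvent Z n z ∩ {ω | Z (n + 1) ω = o} =
      pathEvent Z (n + 1) (Function.update z (n + 1) o) := by
  ext ω
  simp only [pathEvent, Set.mem_inter_iff, Set.mem_ofPred_eq, Nat.le_succ_iff_eq_or_le,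
    forall_eq_or_imp, Function.update_self, and_comm (b := Z (n + 1) ω = o)]
  refine and_congr_right fun _ => forall₂_congr fun m hm => ?_
  rw [Function.update_of_ne (by omega)]

variable {S : Type*} [Fintype S] [DecidableEq S] {α : ℝ} {π : S → ℝ} {T : Matrix S S ℝ} {Ω : Type*}
  [MeasurableSpace Ω] {P : Measure Ω} {Z : ℕ → Ω → Option S} {H : ℕ → S → Ω → ℝ}

namespace IsSemiMarkovModel

variable (hM : IsSemiMarkovModel α π T P Z H)
include hM

lemma measurableSet_chain_eq (n : ℕ) (o : Option S) : MeasurableSet {ω | Z n ω = o} :=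
  hM.measurable_chain n (MeasurableSpace.measurableSet_top (s := {o}))

lemma measurable_comp_chain (n : ℕ) {F : Option S → Ω → ℝ} (hF : ∀ o, Measurable (F o)) :
    Measurable fun ω => F (Z n ω) ω := by
  intro B hB
  have hpreimage : (fun ω => F (Z n ω) ω) ⁻¹' B = ⋃ o, {ω | Z n ω = o} ∩ F o ⁻¹' B := by
    ext ω
    simp
  rw [hpreimage]
  exact MeasurableSet.iUnion fun o => (hM.measurableSet_chain_eq n o).inter (hF o hB)

lemma sojourn_nonneg : ∀ᵐ ω ∂P, ∀ n i, 0 ≤ H n i ω := by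
  simp only [ae_all_iff]
  intro n i
  have hpos := mlDistribution_pos α (-T i i)
  rw [← (hM.sojourn_law n i).map_eq] at hpos
  exact (ae_of_ae_map (hM.measurable_sojourn n i).aemeasurable hpos).mono fun _ => le_of_lt

lemma integral_exp_sojourn (hparam : IsPHParam π T) (hα : 0 < α) (hα' : α ≤ 1) {s : ℝ}
    (hs : 0 < s) (m : ℕ) (i : S) :
    ∫ ω, Real.exp (-(s * H m i ω)) ∂P = -T i i / (s ^ α + -T i i) := by
  rw [← integral_exp_mlDistribution hα hα' (neg_pos.2 (hparam.diag_neg i)).le hs]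
  exact (hM.sojourn_law m i).integral_comp (f := fun x => Real.exp (-(s * x)))
    (by fun_prop : Measurable fun x : ℝ => Real.exp (-(s * x))).aestronglyMeasurable

section Weights

variable {r w : S → ℝ}

lemma measurable_pathWeight_chain (r : S → ℝ) (k : ℕ) :
    Measurable fun ω => pathWeight r k (Z · ω) (H · · ω) := by
  refine Finset.measurable_fun_prod _ fun m _ => hM.measurable_comp_chain m
    (F := fun o ω => o.elim 1 fun i => Real.exp (-(r i * H m i ω))) fun o => ?_
  cases o with
  | none => exact measurable_const
  | some i => exact ((hM.measurable_sojourn m i).const_mul (r i)).neg.exp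

lemma integrable_pathWeight_mul (hr : ∀ i, 0 ≤ r i) (f : Option S → ℝ) (k n : ℕ) :
    Integrable (fun ω => pathWeight r k (Z · ω) (H · · ω) * f (Z n ω)) P := by
  have := hM.isProbabilityMeasure
  refine .of_bound ((hM.measurable_pathWeight_chain r k).mul
    (hM.measurable_comp_chain n fun _ => measurable_const)).aestronglyMeasurable ‖f‖ ?_
  filter_upwards [hM.sojourn_nonneg] with ω hω using norm_pathWeight_mul_le hr k _ hω f _

lemma integral_pathWeight (hw : ∀ m i, ∫ ω, Real.exp (-(r i * H m i ω)) ∂P = w i) (k : ℕ)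
    (z : ℕ → Option S) :
    ∫ ω, pathWeight r k z (H · · ω) ∂P = ∏ m ∈ Finset.range k, (z m).elim 1 w := by
  have := hM.isProbabilityMeasure
  rcases isEmpty_or_nonempty S with hS | ⟨⟨i₀⟩⟩
  · have hz : ∀ m, z m = none := fun m => Subsingleton.elim _ _
    simp [pathWeight, hz]
  let weight : ℕ → ℝ → ℝ := fun m x => (z m).elim 1 fun i => Real.exp (-(r i * x))
  have hweight : ∀ m, Measurable (weight m) := fun m => by
    cases hz : z m with
    | none => simp only [weight, hz, Option.elim_none, measurable_const]
    | some i =>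
      simp only [weight, hz, Option.elim_some]
      fun_prop
  have hindep := (hM.sojourn_indep.precomp (g := fun m : Fin k => ((m : ℕ), (z m).getD i₀))
    fun a b hab => Fin.ext (Prod.ext_iff.1 hab).1).comp (fun m => weight m) fun m => hweight m
  calc ∫ ω, pathWeight r k z (H · · ω) ∂P
      = ∫ ω, ∏ m : Fin k, weight m (H m ((z m).getD i₀) ω) ∂P := by
        refine integral_congr_ae (.of_forall fun ω => ?_)
        beta_reduce
        rw [pathWeight, Fin.prod_univ_eq_prod_range fun m => weight m (H m ((z m).getD i₀) ω)]
        refine Finset.prod_congr rfl fun m _ => ?_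
        simp only [weight]
        cases z m <;> simp
    _ = ∏ m : Fin k, ∫ ω, weight m (H m ((z m).getD i₀) ω) ∂P :=
        hindep.integral_fun_prod_eq_prod_integral fun m =>
          ((hweight m).comp (hM.measurable_sojourn _ _)).aestronglyMeasurable
    _ = ∏ m : Fin k, (z m).elim 1 w := by
        refine Finset.prod_congr rfl fun m _ => ?_
        simp only [weight]
        cases z m <;> simp [hw]
    _ = ∏ m ∈ Finset.range k, (z m).elim 1 w :=
        Fin.prod_univ_eq_prod_range (fun m => (z m).elim 1 w) k

lemma setIntegral_pathWeight (hw : ∀ m i, ∫ ω, Real.exp (-(r i * H m i ω)) ∂P = w i) (k : ℕ)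
    (z : ℕ → Option S) {A : Set Ω}
    (hA : MeasurableSet[⨆ n, MeasurableSpace.comap (Z n) ⊤] A) :
    ∫ ω in A, pathWeight r k z (H · · ω) ∂P =
      P.real A * ∏ m ∈ Finset.range k, (z m).elim 1 w := by
  have := hM.isProbabilityMeasure
  let X : Ω → ℕ → S → ℝ := fun ω n i => H n i ω
  have hX : Measurable X :=
    measurable_pi_lambda _ fun n => measurable_pi_lambda _ fun i => hM.measurable_sojourn n i
  have hcomap : MeasurableSpace.comap X inferInstance ≤
      ⨆ q : ℕ × S, MeasurableSpace.comap (H q.1 q.2) inferInstance := by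
    simp only [MeasurableSpace.pi, MeasurableSpace.comap_iSup, MeasurableSpace.comap_comp]
    exact iSup₂_le fun n i => le_iSup_of_le (n, i) le_rfl
  have hchain : (⨆ n, MeasurableSpace.comap (Z n) ⊤) ≤ (inferInstance : MeasurableSpace Ω) :=
    iSup_le fun n => (hM.measurable_chain n).comap_le
  rw [← hM.integral_pathWeight hw k z, ← smul_eq_mul]
  exact Indep.setIntegral_eq_smul hchain (indep_of_indep_of_le_right hM.chain_indep hcomap)
    hX.aemeasurable hA (measurable_pathWeight r k z).aestronglyMeasurable

omit [Fintype S] [DecidableEq S] hM [MeasurableSpace Ω] in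
lemma measurableSet_comap_pathEvent (n : ℕ) (z : ℕ → Option S) :
    MeasurableSet[⨆ n, MeasurableSpace.comap (Z n) ⊤] (pathEvent Z n z) := by
  simp only [pathEvent, Set.ofPred_forall]
  exact MeasurableSet.iInter fun m => MeasurableSet.iInter fun _ =>
    le_iSup (fun n => MeasurableSpace.comap (Z n) ⊤) m _
      ⟨{z m}, MeasurableSpace.measurableSet_top, rfl⟩

lemma measurableSet_pathEvent (n : ℕ) (z : ℕ → Option S) : MeasurableSet (pathEvent Z n z) :=
  iSup_le (fun n => (hM.measurable_chain n).comap_le) _ (measurableSet_comap_pathEvent n z)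

lemma measureReal_pathEvent_inter (n : ℕ) (z : ℕ → Option S) (o : Option S) :
    P.real (pathEvent Z n z ∩ {ω | Z (n + 1) ω = o}) =
      P.real (pathEvent Z n z) * embedded T (z n) o := by
  rw [pathEvent_inter, pathEvent, hM.markov, pathEvent, hM.markov, Finset.prod_range_succ,
    Function.update_of_ne n.succ_ne_zero.symm, Function.update_of_ne n.lt_succ_self.ne,
    Function.update_self, mul_assoc]
  congr 2
  refine Finset.prod_congr rfl fun m hm => ?_
  have hlt := Finset.mem_range.1 hm
  rw [Function.update_of_ne (by omega), Function.update_of_ne (by omega)]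

lemma setIntegral_pathEvent_succ (hr : ∀ i, 0 ≤ r i)
    (hw : ∀ m i, ∫ ω, Real.exp (-(r i * H m i ω)) ∂P = w i) (f : Option S → ℝ) (n : ℕ)
    (z : ℕ → Option S) :
    ∫ ω in pathEvent Z n z, pathWeight r (n + 1) (Z · ω) (H · · ω) * f (Z (n + 1) ω) ∂P =
      ∫ ω in pathEvent Z n z, pathWeight r n (Z · ω) (H · · ω) *
        ((Z n ω).elim 1 w * ∑ o, embedded T (Z n ω) o * f o) ∂P := by
  have hE := hM.measurableSet_pathEvent n z
  have hnext : ∀ o, ∫ ω in {ω | Z (n + 1) ω = o}, pathWeight r (n + 1) (Z · ω) (H · · ω) *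
      f (Z (n + 1) ω) ∂P.restrict (pathEvent Z n z) =
      P.real (pathEvent Z n z) * embedded T (z n) o *
        (∏ m ∈ Finset.range (n + 1), (z m).elim 1 w) * f o := fun o => by
    have hEo : MeasurableSet (pathEvent Z n z ∩ {ω | Z (n + 1) ω = o}) :=
      hE.inter (hM.measurableSet_chain_eq (n + 1) o)
    rw [Measure.restrict_restrict (hM.measurableSet_chain_eq (n + 1) o), Set.inter_comm,
      ← hM.measureReal_pathEvent_inter, pathEvent_inter, ← hM.setIntegral_pathWeight hw _ _
      (measurableSet_comap_pathEvent _ _), ← integral_mul_const, ← pathEvent_inter]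
    refine setIntegral_congr_fun hEo fun ω hω => ?_
    rw [show Z (n + 1) ω = o from hω.2,
      pathWeight_congr (fun m hm => hω.1 m (Nat.le_of_lt_succ hm)) (H · · ω)]
  have hcurrent : ∫ ω in pathEvent Z n z, pathWeight r n (Z · ω) (H · · ω) *
      ((Z n ω).elim 1 w * ∑ o, embedded T (Z n ω) o * f o) ∂P =
      P.real (pathEvent Z n z) * (∏ m ∈ Finset.range n, (z m).elim 1 w) *
        ((z n).elim 1 w * ∑ o, embedded T (z n) o * f o) := by
    rw [← hM.setIntegral_pathWeight hw n z (measurableSet_comap_pathEvent n z),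
      ← integral_mul_const]
    refine setIntegral_congr_fun hE fun ω hω => ?_
    rw [hω n le_rfl, pathWeight_congr (fun m hm => hω m hm.le) (H · · ω)]
  rw [integral_eq_sum_setIntegral (hM.measurableSet_chain_eq (n + 1))
    (hM.integrable_pathWeight_mul hr f (n + 1) (n + 1)).integrableOn, hcurrent,
    Finset.sum_congr rfl fun o _ => hnext o, Finset.prod_range_succ, Finset.mul_sum,
    Finset.mul_sum]
  exact Finset.sum_congr rfl fun o _ => by ring

lemma integral_pathWeight_succ_mul (hr : ∀ i, 0 ≤ r i)
    (hw : ∀ m i, ∫ ω, Real.exp (-(r i * H m i ω)) ∂P = w i) (f : Option S → ℝ) (n : ℕ) :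
    ∫ ω, pathWeight r (n + 1) (Z · ω) (H · · ω) * f (Z (n + 1) ω) ∂P =
      ∫ ω, pathWeight r n (Z · ω) (H · · ω) *
        ((Z n ω).elim 1 w * ∑ o, embedded T (Z n ω) o * f o) ∂P := by
  have hpath : ∀ v : Fin (n + 1) → Option S, {ω | (fun m : Fin (n + 1) => Z m ω) = v} =
      pathEvent Z n fun m => v (Fin.ofNat (n + 1) m) := fun v => by
    ext ω
    simp only [pathEvent, Set.mem_ofPred_eq, funext_iff]
    refine ⟨fun h m hm => ?_, fun h m => ?_⟩
    · simpa [Nat.mod_eq_of_lt (Nat.lt_succ_of_le hm)] using h (Fin.ofNat (n + 1) m)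
    · simpa using h m (Nat.le_of_lt_succ m.2)
  have hpath_meas : ∀ v : Fin (n + 1) → Option S,
      MeasurableSet {ω | (fun m : Fin (n + 1) => Z m ω) = v} := fun v =>
    hpath v ▸ hM.measurableSet_pathEvent n _
  rw [integral_eq_sum_setIntegral hpath_meas (hM.integrable_pathWeight_mul hr f (n + 1) (n + 1)),
    integral_eq_sum_setIntegral hpath_meas (hM.integrable_pathWeight_mul hr
      (fun o => o.elim 1 w * ∑ o', embedded T o o' * f o') n n)]
  refine Finset.sum_congr rfl fun v _ => ?_
  rw [hpath, hM.setIntegral_pathEvent_succ hr hw]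

lemma integral_chain_zero (f : Option S → ℝ) :
    ∫ ω, f (Z 0 ω) ∂P = ∑ o, initial π o * f o := by
  have := hM.isProbabilityMeasure
  have hint : Integrable (fun ω => f (Z 0 ω)) P := by
    simpa [pathWeight] using hM.integrable_pathWeight_mul (r := 0) (fun _ => le_rfl) f 0 0
  rw [integral_eq_sum_setIntegral (hM.measurableSet_chain_eq 0) hint]
  refine Finset.sum_congr rfl fun o _ => ?_
  have hinit : P.real {ω | Z 0 ω = o} = initial π o := by simpa using hM.markov 0 fun _ => o
  rw [setIntegral_congr_fun (g := fun _ => f o) (hM.measurableSet_chain_eq 0 o)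
    fun ω hω => congrArg f hω, setIntegral_const, hinit, smul_eq_mul]

lemma integral_pathWeight_mul_of_harmonic (hr : ∀ i, 0 ≤ r i)
    (hw : ∀ m i, ∫ ω, Real.exp (-(r i * H m i ω)) ∂P = w i) {f : Option S → ℝ}
    (hf : ∀ o, o.elim 1 w * ∑ o', embedded T o o' * f o' = f o) (n : ℕ) :
    ∫ ω, pathWeight r n (Z · ω) (H · · ω) * f (Z n ω) ∂P = ∑ o, initial π o * f o := by
  induction n with
  | zero => simpa [pathWeight] using hM.integral_chain_zero f
  | succ n ih => simp only [hM.integral_pathWeight_succ_mul hr hw, hf, ih]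

end Weights

section Absorption

lemma integrable_comp_chain (f : Option S → ℝ) (n : ℕ) : Integrable (fun ω => f (Z n ω)) P := by
  simpa [pathWeight] using hM.integrable_pathWeight_mul (r := 0) (fun _ => le_rfl) f 0 n

lemma integral_chain_succ (f : Option S → ℝ) (n : ℕ) :
    ∫ ω, f (Z (n + 1) ω) ∂P = ∫ ω, ∑ o, embedded T (Z n ω) o * f o ∂P := by
  have := hM.isProbabilityMeasure
  have hone : ∀ o : Option S, (o.elim 1 fun _ => (1 : ℝ)) = 1 := fun o => by cases o <;> rfl
  simpa only [pathWeight_zero_left, one_mul, hone] using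
    hM.integral_pathWeight_succ_mul (r := 0) (w := fun _ => 1) (fun _ => le_rfl) (by simp) f n

lemma summable_measureReal_chain_eq (hparam : IsPHParam π T) (i : S) :
    Summable fun n => P.real {ω | Z n ω = some i} := by
  have := hM.isProbabilityMeasure
  let g : Option S → ℝ := fun o => o.elim 0 (T⁻¹ *ᵥ Pi.single i (T i i))
  have hg : ∀ o, ∑ o', embedded T o o' * g o' = g o - if o = some i then 1 else 0 :=
    hparam.sum_embedded_mul_inv_mulVec_single i
  have hstep : ∀ n, P.real {ω | Z n ω = some i} =
      ∫ ω, g (Z n ω) ∂P - ∫ ω, g (Z (n + 1) ω) ∂P := fun n => by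
    have hvisit := hM.integrable_comp_chain (fun o => if o = some i then 1 else 0) n
    simp only [hM.integral_chain_succ, hg]
    rw [integral_sub (hM.integrable_comp_chain _ n) hvisit, sub_sub_cancel,
      ← integral_indicator_one (hM.measurableSet_chain_eq n (some i))]
    exact integral_congr_ae (.of_forall fun ω => by simp [Set.indicator_apply])
  have hbound : ∀ n, |∫ ω, g (Z n ω) ∂P| ≤ ‖g‖ := fun n => by
    simpa using norm_integral_le_of_norm_le_const (μ := P)
      (.of_forall fun ω => norm_le_pi_norm g (Z n ω))
  refine summable_of_sum_range_le (c := ‖g‖ + ‖g‖) (fun n => measureReal_nonneg) fun N => ?_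
  simp only [hstep]
  rw [Finset.sum_range_sub']
  linarith [(abs_le.1 (hbound 0)).2, (abs_le.1 (hbound N)).1]

lemma eventually_absorbed (hparam : IsPHParam π T) :
    ∀ᵐ ω ∂P, ∀ᶠ n in Filter.atTop, Z n ω = none := by
  have := hM.isProbabilityMeasure
  have hleave : ∀ i, ∀ᵐ ω ∂P, ∀ᶠ n in Filter.atTop, Z n ω ≠ some i := fun i => by
    refine ae_eventually_notMem (s := fun n => {ω | Z n ω = some i}) ?_
    exact ne_of_eq_of_ne (tsum_congr fun n => (ofReal_measureReal (measure_ne_top P _)).symm)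
      (hM.summable_measureReal_chain_eq hparam i).tsum_ofReal_ne_top
  filter_upwards [ae_all_iff.2 hleave] with ω hω
  filter_upwards [Filter.eventually_all.2 hω] with n hn
  exact Option.eq_none_iff_forall_ne_some.2 hn

end Absorption

section TotalReward

variable {d : ℕ} (R : Matrix S (Fin d) ℝ) (hparam : IsPHParam π T)
include hparam

lemma eventually_totalReward_eq :
    ∀ᵐ ω ∂P, ∀ᶠ n in Filter.atTop, Z n ω = none ∧
      totalReward R Z H ω = partialReward R Z H n ω := by
  filter_upwards [hM.eventually_absorbed hparam, hM.sojourn_nonneg] with ω hnone hH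
  obtain ⟨M, hM⟩ := Filter.eventually_atTop.1 hnone
  filter_upwards [Filter.eventually_ge_atTop M] with n hn
  exact ⟨hM n hn, totalReward_eq_partialReward hH (fun m hm => hM m (hn.trans hm)) R⟩

omit hparam in
lemma measurable_partialReward (n : ℕ) : Measurable (partialReward R Z H n) := by
  refine measurable_pi_lambda _ fun k => Finset.measurable_fun_sum _ fun m _ =>
    hM.measurable_comp_chain m (F := fun o ω => o.elim 0 fun i => R i k * H m i ω) fun o => ?_
  cases o with
  | none => exact measurable_const
  | some i => exact (hM.measurable_sojourn m i).const_mul _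

lemma aemeasurable_totalReward : AEMeasurable (totalReward R Z H) P := by
  refine aemeasurable_of_tendsto_metrizable_ae Filter.atTop
    (fun n => (hM.measurable_partialReward R n).aemeasurable) ?_
  filter_upwards [hM.eventually_totalReward_eq R hparam] with ω hω
  exact tendsto_const_nhds.congr' (hω.mono fun n hn => hn.2)

lemma totalReward_nonneg (hR : ∀ i k, 0 ≤ R i k) :
    ∀ᵐ ω ∂P, ∀ k, 0 ≤ totalReward R Z H ω k := by
  filter_upwards [hM.eventually_totalReward_eq R hparam, hM.sojourn_nonneg] with ω hω hH k
  obtain ⟨n, -, hn⟩ := hω.exists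
  rw [hn]
  refine Finset.sum_nonneg fun m _ => ?_
  cases Z m ω with
  | none => exact le_rfl
  | some i => exact mul_nonneg (hR i k) (hH m i)

lemma integrable_exp_neg_totalReward {θ : Fin d → ℝ} (hθ : ∀ i, 0 ≤ (R *ᵥ θ) i) :
    Integrable (fun ω => Real.exp (-(totalReward R Z H ω ⬝ᵥ θ))) P := by
  have := hM.isProbabilityMeasure
  refine .of_bound ((measurable_exp_neg_dotProduct θ).comp_aemeasurable
    (hM.aemeasurable_totalReward R hparam)).aestronglyMeasurable 1 ?_
  filter_upwards [hM.eventually_totalReward_eq R hparam, hM.sojourn_nonneg] with ω hω hH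
  obtain ⟨n, -, hn⟩ := hω.exists
  rw [Real.norm_of_nonneg (Real.exp_nonneg _), hn, exp_neg_partialReward_dotProduct]
  exact pathWeight_le_one hθ n _ hH

lemma integral_exp_neg_totalReward (hα : 0 < α) (hα' : α ≤ 1) {θ : Fin d → ℝ}
    (hθ : ∀ i, 0 < (R *ᵥ θ) i) :
    ∫ ω, Real.exp (-(totalReward R Z H ω ⬝ᵥ θ)) ∂P = (1 - ∑ i, π i) +
      π ⬝ᵥ ((diagonal (fun i => (R *ᵥ θ) i ^ α) - T)⁻¹ *ᵥ exitVector T) := by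
  have := hM.isProbabilityMeasure
  have hr : ∀ i, 0 ≤ (R *ᵥ θ) i := fun i => (hθ i).le
  set D : S → ℝ := fun i => (R *ᵥ θ) i ^ α
  have hD : ∀ i, 0 < D i := fun i => Real.rpow_pos_of_pos (hθ i) α
  set x := (diagonal D - T)⁻¹ *ᵥ exitVector T
  have hx : (diagonal D - T) *ᵥ x = exitVector T := mulVec_mulVec_of_mul_eq_one
    (mul_nonsing_inv _ (isUnit_iff_ne_zero.2 (hparam.isSubIntensity.det_ne_zero hD))) _
  let f : Option S → ℝ := fun o => o.elim 1 x
  have hmartingale : ∀ n, ∫ ω, pathWeight (R *ᵥ θ) n (Z · ω) (H · · ω) * f (Z n ω) ∂P =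
      (1 - ∑ i, π i) + π ⬝ᵥ x := fun n => by
    rw [hM.integral_pathWeight_mul_of_harmonic hr
      (fun m i => hM.integral_exp_sojourn hparam hα hα' (hθ i) m i)
      (hparam.discounted_sum_embedded (fun i => (hD i).le) hx) n, Fintype.sum_option]
    simp [initial, dotProduct]
  have hlim : ∀ᵐ ω ∂P, Filter.Tendsto
      (fun n => pathWeight (R *ᵥ θ) n (Z · ω) (H · · ω) * f (Z n ω)) Filter.atTop
      (nhds (Real.exp (-(totalReward R Z H ω ⬝ᵥ θ)))) := by
    filter_upwards [hM.eventually_totalReward_eq R hparam] with ω hω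
    refine tendsto_const_nhds.congr' (hω.mono fun n hn => ?_)
    beta_reduce
    rw [hn.2, hn.1, exp_neg_partialReward_dotProduct, show f none = 1 from rfl, mul_one]
  have hdct := tendsto_integral_of_dominated_convergence (fun _ => ‖f‖)
    (fun n => (hM.integrable_pathWeight_mul hr f n n).1) (integrable_const _) (fun n => by
      filter_upwards [hM.sojourn_nonneg] with ω hH using norm_pathWeight_mul_le hr n _ hH f _) hlim
  simp only [hmartingale] at hdct
  exact tendsto_nhds_unique hdct tendsto_const_nhds

end TotalReward

end IsSemiMarkovModel

end Model

lemma blockR_nonneg (p₁ p₂ p₃ : ℕ) (i : Fin p₁ ⊕ (Fin p₂ ⊕ Fin p₃)) (k : Fin 2) :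
    0 ≤ blockR p₁ p₂ p₃ i k := by
  rcases i with i | i | i <;> fin_cases k <;> simp [blockR]

theorem IsSemiMarkovModel.hasExplicitForm {p₁ p₂ p₃ : ℕ} {α : ℝ}
    {π₁ : Fin p₁ → ℝ} {π₂ : Fin p₂ → ℝ} {π₃ : Fin p₃ → ℝ}
    {T₁₁ : Matrix (Fin p₁) (Fin p₁) ℝ} {T₁₂ : Matrix (Fin p₁) (Fin p₂) ℝ}
    {T₁₃ : Matrix (Fin p₁) (Fin p₃) ℝ} {T₂₂ : Matrix (Fin p₂) (Fin p₂) ℝ}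
    {T₃₃ : Matrix (Fin p₃) (Fin p₃) ℝ} {Ω : Type*} [MeasurableSpace Ω] {P : Measure Ω}
    {Z : ℕ → Ω → Option (Fin p₁ ⊕ (Fin p₂ ⊕ Fin p₃))}
    {H : ℕ → Fin p₁ ⊕ (Fin p₂ ⊕ Fin p₃) → Ω → ℝ}
    (hM : IsSemiMarkovModel α (blockInit π₁ π₂ π₃) (blockT T₁₁ T₁₂ T₁₃ T₂₂ T₃₃) P Z H)
    (hα : 0 < α) (hα' : α ≤ 1)
    (hparam : IsPHParam (blockInit π₁ π₂ π₃) (blockT T₁₁ T₁₂ T₁₃ T₂₂ T₃₃)) :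
    HasExplicitForm α π₁ π₂ π₃ T₁₁ T₁₂ T₁₃ T₂₂ T₃₃
      (P.map (totalReward (blockR p₁ p₂ p₃) Z H)) := by
  have hY := hM.aemeasurable_totalReward (blockR p₁ p₂ p₃) hparam
  refine hasExplicitForm_of_lintegral_exp_neg hα hα' hparam ?_ fun θ hθ => ?_
  · rw [ae_map_iff hY (by measurability)]
    exact hM.totalReward_nonneg _ hparam (blockR_nonneg p₁ p₂ p₃)
  · have hRθ : ∀ i, 0 < (blockR p₁ p₂ p₃ *ᵥ θ) i := fun i => by
      rw [blockR_mulVec]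
      rcases i with _ | _ | _
      exacts [add_pos (hθ 0) (hθ 1), hθ 0, hθ 1]
    rw [lintegral_map' (measurable_exp_neg_dotProduct θ).ennreal_ofReal.aemeasurable hY,
      ← hM.integral_exp_neg_totalReward (blockR p₁ p₂ p₃) hparam hα hα' hRθ,
      ofReal_integral_eq_lintegral_ofReal
        (hM.integrable_exp_neg_totalReward _ hparam fun i => (hRθ i).le)
        (.of_forall fun _ => Real.exp_nonneg _)]

end MPHalpha

theorem mainTheorem6 {p₁ p₂ p₃ : ℕ} (α : ℝ) (hα : 0 < α) (hα' : α ≤ 1)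
    (π₁ : Fin p₁ → ℝ) (π₂ : Fin p₂ → ℝ) (π₃ : Fin p₃ → ℝ)
    (T₁₁ : Matrix (Fin p₁) (Fin p₁) ℝ) (T₁₂ : Matrix (Fin p₁) (Fin p₂) ℝ)
    (T₁₃ : Matrix (Fin p₁) (Fin p₃) ℝ) (T₂₂ : Matrix (Fin p₂) (Fin p₂) ℝ)
    (T₃₃ : Matrix (Fin p₃) (Fin p₃) ℝ)
    (hparam : MPHalpha.IsPHParam (MPHalpha.blockInit π₁ π₂ π₃)
      (MPHalpha.blockT T₁₁ T₁₂ T₁₃ T₂₂ T₃₃)) :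
    -- every distribution with the Laplace transform of `MPH*_α(π, T, R)` has the explicit form
    (∀ μ : Measure (Fin 2 → ℝ),
      MPHalpha.IsMPH α (MPHalpha.blockInit π₁ π₂ π₃) (MPHalpha.blockT T₁₁ T₁₂ T₁₃ T₂₂ T₃₃)
        (MPHalpha.blockR p₁ p₂ p₃) μ →
      MPHalpha.HasExplicitForm α π₁ π₂ π₃ T₁₁ T₁₂ T₁₃ T₂₂ T₃₃ μ) ∧
    -- so does the joint law of the total rewards of every underlying semi-Markov process
    (∀ {Ω : Type*} [MeasurableSpace Ω] (P : Measure Ω)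
      (Z : ℕ → Ω → Option (Fin p₁ ⊕ (Fin p₂ ⊕ Fin p₃)))
      (H : ℕ → Fin p₁ ⊕ (Fin p₂ ⊕ Fin p₃) → Ω → ℝ),
      MPHalpha.IsSemiMarkovModel α (MPHalpha.blockInit π₁ π₂ π₃)
        (MPHalpha.blockT T₁₁ T₁₂ T₁₃ T₂₂ T₃₃) P Z H →
      AEMeasurable (MPHalpha.totalReward (MPHalpha.blockR p₁ p₂ p₃) Z H) P ∧
      MPHalpha.HasExplicitForm α π₁ π₂ π₃ T₁₁ T₁₂ T₁₃ T₂₂ T₃₃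
        (P.map (MPHalpha.totalReward (MPHalpha.blockR p₁ p₂ p₃) Z H))) :=
  ⟨fun _ hμ => hμ.hasExplicitForm hα hα' hparam, fun _ _ _ hM =>
    ⟨hM.aemeasurable_totalReward _ hparam, hM.hasExplicitForm hα hα' hparam⟩⟩
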